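/- Let $s\ge 1$ be an integer and let $g=(g_{\lambda\mu})_{0\le\lambda,\mu\le s}$ be an invertible real symmetric matrix with inverse $(g^{\lambda\mu})$. Let $\mathcal A$ be the cubic Yang–Mills algebra: the unital associative $\mathbb C$-algebra generated by $\nabla_0,\dots,\nabla_s$ with the relations $\sum_{\lambda,\mu}g^{\lambda\mu}[\nabla_\lambda,[\nabla_\mu,\nabla_\nu]]=0$ for $\nu=0,\dots,s$. Thus $\mathcal A=A(E,R)=T(E)/(R)$, where $E=\bigoplus_\lambda\mathbb C\nabla_\lambda$ and $R\subset E^{\otimes 3}$ is the span of the $s+1$ tensors on the left-hand sides. Let $\mathcal A^!=A(E^*,R^\perp)$ be the dual cubic algebra, where $R^\perp\subset (E^*)^{\otimes 3}$ is the annihilator of $R$, and let $\mathcal A^!_n$ be its component of degree $n$. Put $K_n=\mathcal A\otimes(\mathcal A^!_n)^*$, with the left $\mathcal A$-linear map $d:K_{n+1}\to K_n$, $d(a\otimes f)=\sum_\lambda a\nabla_\lambda\otimes f(\theta^\lambda\,\cdot\,)$, where $(\theta^\lambda)$ is the basis of $E^*$ dual to $(\nabla_\lambda)$. The Koszul complex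 of $\mathcal A$ is $$\cdots\xrightarrow{d^2}K_4\xrightarrow{d}K_3\xrightarrow{d^2}K_1\xrightarrow{d}K_0\to 0,$$ with terms $C_{2j}=K_{3j}$ and $C_{2j+1}=K_{3j+1}$ and with differentials alternately $d$ and $d^2$. Theorem 1. (i) $\mathcal A$ is Koszul (in Berger's sense): its Koszul complex is acyclic in all positive degrees. (ii) $\mathcal A$ has global dimension $3$: the Koszul complex satisfies $C_3\neq 0$ and $C_n=0$ for $n>3$, and the left and the right global dimension of the ring $\mathcal A$ (the suprema of the projective dimensions of all left, respectively right, modules) are both equal to $3$. (iii) $\mathcal A$ is Gorenstein: the cochain complex of right $\mathcal A$-modules $\operatorname{Hom}_{\mathcal A}(C_\bullet,\mathcal A)$ has cohomology $H^k=0$ for $k<3$, and $H^3$ is isomorphic to the trivial right $\mathcal A$-module $\mathbb C$, on which every $\nabla_\lambda$ acts as $0$. -/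

import Mathlib

open scoped TensorProduct

noncomputable section

universe u v

/-- The quotient `Z / (Z ∩ B)` for submodules `Z`, `B` of a module; it is `Z / B` if `B ≤ Z`. -/
def Subquotient {A : Type u} [Ring A] {M : Type v} [AddCommGroup M] [Module A M]
    (Z B : Submodule A M) : Type v :=
  Z ⧸ B.submoduleOf Z

instance {A : Type u} [Ring A] {M : Type v} [AddCommGroup M] [Module A M]
    (Z B : Submodule A M) : AddCommGroup (Subquotient Z B) :=
  inferInstanceAs (AddCommGroup (Z ⧸ B.submoduleOf Z))

instance {A : Type u} [Ring A] {M : Type v} [AddCommGroup M] [Module A M]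
    (Z B : Submodule A M) : Module A (Subquotient Z B) :=
  inferInstanceAs (Module A (Z ⧸ B.submoduleOf Z))

/-! ### `N`-homogeneous algebras -/

/-- The relations `t = 0` in the tensor algebra `T(E)`, one for every `t` in the subspace `R` of
`E^{⊗N}`. -/
def HomogeneousRel {K : Type u} [Field K] {E : Type v} [AddCommGroup E] [Module K E] {N : ℕ}
    (R : Submodule K (⨂[K]^N E)) (x y : TensorAlgebra K E) : Prop :=
  (∃ t ∈ R, TensorPower.toTensorAlgebra t = x) ∧ y = 0

/-- The `N`-homogeneous algebra `A(E, R) = T(E)/(R)`. -/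
def HomogeneousAlgebra {K : Type u} [Field K] {E : Type v} [AddCommGroup E] [Module K E] {N : ℕ}
    (R : Submodule K (⨂[K]^N E)) : Type (max u v) :=
  RingQuot (HomogeneousRel R)

namespace HomogeneousAlgebra

section General

variable {K : Type u} [Field K] {E : Type v} [AddCommGroup E] [Module K E] {N : ℕ}
variable (R : Submodule K (⨂[K]^N E))

instance : Ring (HomogeneousAlgebra R) :=
  inferInstanceAs (Ring (RingQuot (HomogeneousRel R)))

instance : Algebra K (HomogeneousAlgebra R) :=
  inferInstanceAs (Algebra K (RingQuot (HomogeneousRel R)))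

/-- The projection `T(E) → A(E, R)`. -/
def mk : TensorAlgebra K E →ₐ[K] HomogeneousAlgebra R :=
  RingQuot.mkAlgHom K (HomogeneousRel R)

/-- The map `E → A(E, R)`, with image the component of degree one. -/
def gen : E →ₗ[K] HomogeneousAlgebra R :=
  (mk R).toLinearMap ∘ₗ TensorAlgebra.ι K

/-- The homogeneous component of degree `n` of `A(E, R)`: the image of `E^{⊗n}`, that is the
span of the products of `n` generators. -/
def component (n : ℕ) : Submodule K (HomogeneousAlgebra R) :=
  LinearMap.range (gen R) ^ n

/-- The augmentation `ε : A(E, R) → K` (for `N ≠ 0`), the projection onto degree zero. -/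
def augmentation [NeZero N] : HomogeneousAlgebra R →ₐ[K] K :=
  RingQuot.liftAlgHom K ⟨TensorAlgebra.lift K (0 : E →ₗ[K] K), by
    intro x y h
    obtain ⟨⟨t, -, rfl⟩, rfl⟩ := h
    rw [map_zero (TensorAlgebra.lift K (0 : E →ₗ[K] K))]
    induction t using PiTensorProduct.induction_on with
    | smul_tprod r a =>
      obtain ⟨k, rfl⟩ := Nat.exists_eq_succ_of_ne_zero (NeZero.ne N)
      rw [map_smul, map_smul, TensorPower.toTensorAlgebra_tprod, TensorAlgebra.tprod_apply,
        List.ofFn_succ, List.prod_cons, map_mul, TensorAlgebra.lift_ι_apply]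
      simp
    | add x y hx hy => rw [map_add, map_add, hx, hy, add_zero]⟩

/-- The annihilator `R^⊥ ⊆ (E^*)^{⊗N} = (E^{⊗N})^*` of `R`. -/
def perp : Submodule K (⨂[K]^N (Module.Dual K E)) :=
  R.dualAnnihilator.comap (TensorPower.pairingDual K E N)

/-- The component of degree `n` of the dual algebra `A^! = A(E^*, R^⊥)`. -/
abbrev dualComponent (n : ℕ) : Submodule K (HomogeneousAlgebra (perp R)) :=
  component (perp R) n

/-- Left multiplication by `θ ∈ E^* = A^!_1`, as a map `A^!_n → A^!_{n+1}`. -/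
def dualMul (θ : Module.Dual K E) (n : ℕ) : dualComponent R n →ₗ[K] dualComponent R (n + 1) :=
  (LinearMap.mulLeft K (gen (perp R) θ)).restrict fun x hx => by
    have h := Submodule.mul_mem_mul (LinearMap.mem_range_self (gen (perp R)) θ) hx
    exact (pow_succ' (LinearMap.range (gen (perp R))) n).ge h

/-- The left `A`-module `K_n(A) = A ⊗ (A^!_n)^*`. -/
abbrev KoszulModule (n : ℕ) : Type (max u v) :=
  HomogeneousAlgebra R ⊗[K] Module.Dual K (dualComponent R n)

end General

section Koszul

variable {K : Type u} [Field K] {ι : Type v} [Fintype ι] [DecidableEq ι] {N : ℕ}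
variable (R : Submodule K (⨂[K]^N (ι → K)))

/-- The `N`-differential `d : K_{n+1}(A) → K_n(A)` for `E = K^ι` with canonical basis `(e_i)`
and dual basis `(θ^i)`: `d (a ⊗ f) = ∑ i, a e_i ⊗ f (θ^i ·)`. For `(A^!_n)^*` seen in `E^{⊗n}`
this is the map `a ⊗ (e_0 ⊗ e_1 ⊗ ⋯ ⊗ e_n) ↦ a e_0 ⊗ (e_1 ⊗ ⋯ ⊗ e_n)`. -/
def koszulD (n : ℕ) : KoszulModule R (n + 1) →ₗ[HomogeneousAlgebra R] KoszulModule R n :=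
  ∑ i : ι, TensorProduct.AlgebraTensorModule.map
    (LinearMap.toSpanSingleton (HomogeneousAlgebra R) (HomogeneousAlgebra R)
      (gen R (Pi.single i 1)))
    (dualMul R (LinearMap.proj i) n).dualMap

/-- The power `d^k : K_{n+k}(A) → K_n(A)` of the `N`-differential. -/
def koszulDPow (n : ℕ) :
    (k : ℕ) → KoszulModule R (n + k) →ₗ[HomogeneousAlgebra R] KoszulModule R n
  | 0 => LinearMap.id
  | k + 1 => koszulDPow n k ∘ₗ koszulD R (n + k)

end Koszul

/-- The number of arrows `d` put together in the `n`-th arrow `C_{n+1} → C_n` of the contraction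
`C_{N-1,0}`: alternatively `1` and `N - 1`. -/
def koszulStep (N n : ℕ) : ℕ := if n % 2 = 0 then 1 else N - 1

/-- The `n`-th term of the contraction `C_{N-1,0}` is `K_m(A)` with `m = koszulIdx N n`:
`0, 1, N, N + 1, 2N, 2N + 1, …`. -/
def koszulIdx (N : ℕ) : ℕ → ℕ
  | 0 => 0
  | n + 1 => koszulIdx N n + koszulStep N n

section Complex

variable {K : Type u} [Field K] {ι : Type v} [Fintype ι] [DecidableEq ι] {N : ℕ}
variable (R : Submodule K (⨂[K]^N (ι → K)))

/-- The `n`-th term of the Koszul complex `C_{N-1,0}(K(A))`. -/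
abbrev KoszulTerm (n : ℕ) : Type (max u v) := KoszulModule R (koszulIdx N n)

/-- The differential `C_{n+1} → C_n` of the Koszul complex. -/
def koszulDiff (n : ℕ) : KoszulTerm R (n + 1) →ₗ[HomogeneousAlgebra R] KoszulTerm R n :=
  koszulDPow R (koszulIdx N n) (koszulStep N n)

/-- `A` is Koszul: the Koszul complex is acyclic in all positive degrees. -/
def IsKoszul : Prop :=
  ∀ n : ℕ, Function.Exact (koszulDiff R (n + 1)) (koszulDiff R n)

/-- The Koszul complex has finite extension `D`. -/
def HasFiniteExtension (D : ℕ) : Prop :=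
  (∀ n, D < n → Subsingleton (KoszulTerm R n)) ∧ Nontrivial (KoszulTerm R D)

/-- The `n`-th term `Hom_A(C_n, A)` of the dual of the Koszul complex. It is a right `A`-module
(a module over the opposite ring) through the right multiplication of `A`. -/
abbrev DualTerm (n : ℕ) : Type (max u v) :=
  KoszulTerm R n →ₗ[HomogeneousAlgebra R] HomogeneousAlgebra R

/-- The right `A`-linear differential `φ ↦ φ ∘ d` of the dual of the Koszul complex. -/
def dualDiff (n : ℕ) : DualTerm R n →ₗ[(HomogeneousAlgebra R)ᵐᵒᵖ] DualTerm R (n + 1) where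
  toFun φ := φ ∘ₗ koszulDiff R n
  map_add' _ _ := rfl
  map_smul' _ _ := rfl

/-- The coboundaries in degree `n` of the dual of the Koszul complex. -/
def coboundaries : (n : ℕ) → Submodule (HomogeneousAlgebra R)ᵐᵒᵖ (DualTerm R n)
  | 0 => ⊥
  | n + 1 => LinearMap.range (dualDiff R n)

/-- The cohomology in degree `n` of the dual of the Koszul complex, a right `A`-module. -/
abbrev DualCohomology (n : ℕ) : Type (max u v) :=
  Subquotient (LinearMap.ker (dualDiff R n)) (coboundaries R n)

/-- `A` is Gorenstein: it is Koszul, its Koszul complex has a finite extension `D`, and the dual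
of the Koszul complex is a resolution of the trivial right `A`-module `K`, on which `a ∈ A` acts
as multiplication by `ε a`. -/
def IsGorenstein [NeZero N] : Prop :=
  IsKoszul R ∧ ∃ D : ℕ, HasFiniteExtension R D ∧
    (∀ k < D, Subsingleton (DualCohomology R k)) ∧
    ∃ e : DualCohomology R D ≃+ K, ∀ (a : HomogeneousAlgebra R) (h : DualCohomology R D),
      e (MulOpposite.op a • h) = e h * augmentation R a

end Complex

end HomogeneousAlgebra

/-! ### Global dimension -/

/-- The left global dimension of a ring: the supremum of the projective dimensions of all left
modules. -/
def leftGlobalDimension (A : Type u) [Ring A] : WithBot ℕ∞ :=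
  ⨆ M : ModuleCat.{u} A, CategoryTheory.projectiveDimension M

/-- The right global dimension of a ring. -/
def rightGlobalDimension (A : Type u) [Ring A] : WithBot ℕ∞ :=
  leftGlobalDimension Aᵐᵒᵖ

/-! ### The cubic Yang–Mills algebra -/

/-- The tensor `∇_i ⊗ ∇_j ⊗ ∇_k` in `E^{⊗3}`, for `E` with basis `∇_0, …, ∇_s`. -/
def nabla3 {s : ℕ} (i j k : Fin (s + 1)) : ⨂[ℂ]^3 (Fin (s + 1) → ℂ) :=
  PiTensorProduct.tprod ℂ ![Pi.single i 1, Pi.single j 1, Pi.single k 1]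

/-- The subspace `R` of `E^{⊗3}` spanned by the tensors
`g^{λμ} [∇_λ, [∇_μ, ∇_ν]]`, `ν = 0, …, s`, where `(g^{λμ})` is the inverse of the matrix `g`
and the brackets are commutators in `T(E)`. -/
def yangMillsRelations {s : ℕ} (g : Matrix (Fin (s + 1)) (Fin (s + 1)) ℝ) :
    Submodule ℂ (⨂[ℂ]^3 (Fin (s + 1) → ℂ)) :=
  Submodule.span ℂ (Set.range fun ν : Fin (s + 1) =>
    ∑ l : Fin (s + 1), ∑ m : Fin (s + 1), ((g⁻¹ l m : ℝ) : ℂ) •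
      (nabla3 l m ν - nabla3 l ν m - nabla3 m ν l + nabla3 ν m l))

/-- The cubic Yang–Mills algebra: generators `∇_0, …, ∇_s` and relations
`g^{λμ} [∇_λ, [∇_μ, ∇_ν]] = 0`, `ν = 0, …, s`. -/
abbrev YangMillsAlgebra {s : ℕ} (g : Matrix (Fin (s + 1)) (Fin (s + 1)) ℝ) : Type :=
  HomogeneousAlgebra (yangMillsRelations g)

end

noncomputable section

universe u v

set_option linter.unusedSectionVars false

/-! ### Families satisfying the Yang–Mills relations -/

/-! Over `ℂ` the symmetric form `g⁻¹` can be written as a sum of squares, so a change of basis turns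
the relations into `∑_l [x_l, [x_l, x_n]] = 0` (`yangMillsRelations_eq`). Everything then rests on a
resolution of an arbitrary left module `M`, `0 → A ⊗ M → (A ⊗ M)^ι → (A ⊗ M)^ι → A ⊗ M → M → 0`,
whose maps are built from the operators `S_i (a ⊗ m) = a x_i ⊗ m - a ⊗ x_i m`. These again satisfy
the Yang–Mills relations, and this makes the composites vanish.

The right half is exact because `A` is given by these generators and relations
(`exact_ymD1_tensorAct`, `exact_ymD2_ymD1`). The left half is a leading coefficient argument: `x_i ↦
x_i + t` extends to a homomorphism `A → A[t]`, under which `S_i` becomes `S_i + t` and the other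
`S_j` are unchanged (`DegreeSystem.exact_ymD3_ymD2`). Two distinct indices are needed here, whence
`s ≥ 1`.

The terms are free over `A`, so all projective dimensions are at most `3`; for the trivial module
the resolution is minimal, so the bound is attained. The relations are palindromic, hence `Aᵐᵒᵖ` is
an algebra of the same kind, and the right global dimension follows.

For `M = ℂ` the resolution is the Koszul complex. To see this, the linear forms on the dual algebra
are computed as functions on words: in degree three they are spanned by the relations, in degree
four by one cyclically invariant tensor, and from degree five on they vanish (`exists_form_three`,
`exists_form_four`, `form_five`). Finally, transposition carries the matrices of the Koszul complex
of `A` to those of the resolution over `Aᵐᵒᵖ` in reversed order, so the dual complex is again a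
resolution of `ℂ`: this is the Gorenstein property. -/

/-- The cubic Yang–Mills relations, for the standard metric. -/
def YangMillsRel {ι : Type*} [Fintype ι] {S : Type*} [Ring S] (y : ι → S) : Prop :=
  ∀ n, ∑ l, ⁅y l, ⁅y l, y n⁆⁆ = 0

theorem lie_sub_sub_of_commute {S : Type*} [Ring S] {a b c d : S} (h : Commute a d)
    (h' : Commute c b) : ⁅a - b, c - d⁆ = ⁅a, c⁆ + ⁅b, d⁆ := by
  simp only [Ring.lie_def, sub_mul, mul_sub, h.eq, h'.eq]
  abel

/-- Mixed brackets of commuting families vanish, so the triple bracket of the differences splits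
into the two pure ones. This is used both for the operators `S_i` on `A ⊗ M` and for the shift of
one generator. -/
theorem YangMillsRel.sub_of_commute {ι : Type*} [Fintype ι] {S : Type*} [Ring S] {y z : ι → S}
    (hy : YangMillsRel y) (hz : YangMillsRel z) (h : ∀ i j, Commute (y i) (z j)) :
    YangMillsRel (fun i => y i - z i) := by
  intro n
  have key : ∀ l, ⁅y l - z l, ⁅y l - z l, y n - z n⁆⁆ = ⁅y l, ⁅y l, y n⁆⁆ - ⁅z l, ⁅z l, z n⁆⁆ := by
    intro l
    have h1 : ∀ i, Commute (y i) (-⁅z l, z n⁆) := fun i =>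
      (((h i l).mul_right (h i n)).sub_right ((h i n).mul_right (h i l))).neg_right
    have h2 : ∀ i, Commute ⁅y l, y n⁆ (z i) := fun i =>
      ((h l i).mul_left (h n i)).sub_left ((h n i).mul_left (h l i))
    rw [lie_sub_sub_of_commute (h l n) (h n l), ← sub_neg_eq_add ⁅y l, y n⁆,
      lie_sub_sub_of_commute (h1 l) (h2 l)]
    simp only [Ring.lie_def]
    noncomm_ring
  rw [Finset.sum_congr rfl fun l _ => key l, Finset.sum_sub_distrib, hy n, hz n, sub_zero]

theorem YangMillsRel.map {ι : Type*} [Fintype ι] {S T : Type*} [Ring S] [Ring T] {y : ι → S}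
    (hy : YangMillsRel y) (f : S →+* T) : YangMillsRel (fun i => f (y i)) := by
  intro n
  have := congrArg f (hy n)
  simpa [Ring.lie_def] using this

theorem yangMillsRel_iff {ι : Type*} [Fintype ι] {S : Type*} [Ring S] (y : ι → S) :
    YangMillsRel y ↔
      ∀ n, ∑ l, (y l * y l * y n - 2 * (y l * y n * y l) + y n * y l * y l) = 0 := by
  refine forall_congr' fun n => ?_
  rw [Finset.sum_congr rfl fun l _ => ?_]
  rw [Ring.lie_def, Ring.lie_def]
  noncomm_ring

/-- Expanded into words, the relation is unchanged when every word is reversed. -/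
theorem YangMillsRel.op {ι : Type*} [Fintype ι] {S : Type*} [Ring S] {y : ι → S}
    (hy : YangMillsRel y) : YangMillsRel (fun i => MulOpposite.op (y i)) := by
  rw [yangMillsRel_iff] at hy ⊢
  intro n
  apply MulOpposite.unop_injective
  rw [MulOpposite.unop_zero, ← hy n, ← MulOpposite.opAddEquiv_symm_apply, map_sum]
  refine Finset.sum_congr rfl fun l _ => ?_
  simp only [MulOpposite.opAddEquiv_symm_apply, MulOpposite.unop_add, MulOpposite.unop_sub,
    MulOpposite.unop_mul, MulOpposite.unop_op, two_mul]
  noncomm_ring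

/-! ### The Yang–Mills complex of a family of endomorphisms -/

section Complex

variable {ι : Type*} [Fintype ι] {A : Type*} [Ring A] {N : Type*} [AddCommGroup N] [Module A N]

/-- The map `n ↦ (S_i n)_i`. -/
def ymD3 (S : ι → Module.End A N) : N →ₗ[A] (ι → N) := LinearMap.pi S

/-- The quadratic map with entries `∑ S_l S_l δ_{ij} + S_i S_j - 2 S_j S_i`. -/
def ymD2 (S : ι → Module.End A N) : (ι → N) →ₗ[A] (ι → N) :=
  LinearMap.pi fun i => (∑ l, S l * S l) ∘ₗ LinearMap.proj i +
    ∑ j, (S i * S j - 2 * (S j * S i)) ∘ₗ LinearMap.proj j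

/-- The map `(n_i)_i ↦ ∑ S_i n_i`. -/
def ymD1 (S : ι → Module.End A N) : (ι → N) →ₗ[A] N := ∑ i, S i ∘ₗ LinearMap.proj i

theorem ymD3_apply (S : ι → Module.End A N) (n : N) (i : ι) : ymD3 S n i = S i n := rfl

theorem ymD1_apply (S : ι → Module.End A N) (n : ι → N) : ymD1 S n = ∑ i, S i (n i) := by
  simp [ymD1]

theorem ymD2_apply (S : ι → Module.End A N) (n : ι → N) (i : ι) :
    ymD2 S n i = ∑ l, S l (S l (n i)) + ∑ j, (S i (S j (n j)) - (2 : ℤ) • S j (S i (n j))) := by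
  simp [ymD2, two_mul, two_smul]

theorem ymD2_ymD3 {S : ι → Module.End A N} (hS : YangMillsRel S) (n : N) :
    ymD2 S (ymD3 S n) = 0 := by
  funext i
  have h := LinearMap.congr_fun ((yangMillsRel_iff S).1 hS i) n
  rw [ymD2_apply, ← Finset.sum_add_distrib]
  rw [LinearMap.sum_apply] at h
  refine Eq.trans (Finset.sum_congr rfl fun l _ => ?_) h
  simp only [ymD3_apply, LinearMap.add_apply, LinearMap.sub_apply, Module.End.mul_apply, two_mul,
    two_smul]
  abel

theorem ymD1_ymD2 {S : ι → Module.End A N} (hS : YangMillsRel S) (n : ι → N) :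
    ymD1 S (ymD2 S n) = 0 := by
  have h : ∀ j, ∑ i, (S i (S i (S j (n j))) - (2 : ℤ) • S i (S j (S i (n j))) +
      S j (S i (S i (n j)))) = 0 := by
    intro j
    have h := LinearMap.congr_fun ((yangMillsRel_iff S).1 hS j) (n j)
    rw [LinearMap.sum_apply] at h
    refine Eq.trans (Finset.sum_congr rfl fun l _ => ?_) h
    simp only [LinearMap.add_apply, LinearMap.sub_apply, Module.End.mul_apply, two_mul, two_smul]
  have h2 := Finset.sum_eq_zero fun j (_ : j ∈ Finset.univ) => h j
  rw [ymD1_apply]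
  simp only [ymD2_apply, map_add, map_sum, map_sub, map_zsmul, Finset.sum_add_distrib,
    Finset.sum_sub_distrib] at h2 ⊢
  rw [Finset.sum_comm (f := fun x y => S y (S y (S x (n x)))),
    Finset.sum_comm (f := fun x y => (2 : ℤ) • S y (S x (S y (n x))))] at h2
  rw [← h2]
  abel

/-- A family of operators `δ_k`, to be thought of as taking coefficients in powers of `t`, such
that `S_i` acts as `S_i + t` and the other `S_j` as `S_j`. -/
structure DegreeSystem (S : ι → Module.End A N) (i : ι) (δ : ℕ → N →+ N) : Prop where
  zero (n : N) : δ 0 n = n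
  eventually (n : N) : ∃ m, ∀ k, m ≤ k → δ k n = 0
  same (k : ℕ) (n : N) : δ (k + 1) (S i n) = S i (δ (k + 1) n) + δ k n
  other (j : ι) (h : j ≠ i) (k : ℕ) (n : N) : δ k (S j n) = S j (δ k n)
  decomp (n : N) : ∃ b, ∀ k, δ (k + 1) (n - S i b) = 0

namespace DegreeSystem

variable {S : ι → Module.End A N} {i : ι} {δ : ℕ → N →+ N}

/-- Descending induction on the degree in `t`: all coefficients beyond some degree vanish, and `δ 0`
is the identity. -/
theorem eq_zero (h : DegreeSystem S i δ) {n : N} (hn : ∀ k, (∀ l, k < l → δ l n = 0) → δ k n = 0) :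
    n = 0 := by
  obtain ⟨m, hm⟩ := h.eventually n
  have : ∀ d k, m ≤ k + d → δ k n = 0 := by
    intro d
    induction d with
    | zero => exact fun k hk => hm k hk
    | succ d ih => exact fun k hk => hn k fun l hl => ih l (by lia)
  rw [← h.zero n]
  exact this m 0 (by simp)

/-- The leading coefficient of `(S_i + t) n` is that of `n`. -/
theorem injective (h : DegreeSystem S i δ) : Function.Injective (S i) := by
  rw [injective_iff_map_eq_zero]
  intro n hn
  refine h.eq_zero fun k hk => ?_
  have := h.same k n
  rwa [hn, map_zero, hk (k + 1) (by simp), map_zero, zero_add, eq_comm] at this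

theorem ymD3_injective (h : DegreeSystem S i δ) : Function.Injective (ymD3 S) :=
  fun _ _ hab => h.injective (congrFun hab i)

theorem exact_ymD3_ymD2 (hS : YangMillsRel S) (h : DegreeSystem S i δ) {j : ι} (hj : j ≠ i)
    {δ' : ℕ → N →+ N} (h' : DegreeSystem S j δ') : Function.Exact (ymD3 S) (ymD2 S) := by
  classical
  intro n
  refine ⟨fun hn => ?_, ?_⟩
  swap
  · rintro ⟨b, rfl⟩
    exact ymD2_ymD3 hS b
  -- Subtracting the boundary of `b` makes the `i`-th component constant in `t`; it remains to show
  -- that the whole corrected cycle is zero.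
  obtain ⟨b, hb⟩ := h.decomp (n i)
  set n' := n - ymD3 S b with hn'
  have hn'0 : ymD2 S n' = 0 := by rw [hn', map_sub, hn, ymD2_ymD3 hS, sub_self]
  replace hb : ∀ k, δ (k + 1) (n' i) = 0 := hb
  -- If the components other than `i` have degree at most `m`, then in row `l` the term `S_i S_i
  -- n'_l` alone reaches degree `m + 2`, with coefficient `δ m (n' l)`: the terms in `n' i` have
  -- degree at most one, the remaining ones at most `m`, or `m + 1` where one `S_i` acts.
  have key : ∀ m, (∀ l k, l ≠ i → m < k → δ k (n' l) = 0) → ∀ l, l ≠ i → δ m (n' l) = 0 := by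
    intro m hm l hl
    have e := congrArg (δ (m + 2)) (congrFun hn'0 l)
    rw [ymD2_apply, Pi.zero_apply, map_zero, map_add, map_sum, map_sum] at e
    rw [Finset.sum_eq_single i, Finset.sum_eq_zero, add_zero] at e
    · rw [h.same, h.same, h.same, hm _ _ hl (by lia), hm _ _ hl (by lia)] at e
      simpa using e
    · intro p _
      by_cases hp : p = i
      · subst hp
        rw [map_sub, map_zsmul, h.other l hl, h.same, h.same, h.other l hl, h.other l hl, hb, hb]
        simp
      · rw [map_sub, map_zsmul, h.other l hl, h.other p hp, h.other p hp, h.other l hl,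
          hm _ _ hp (by lia)]
        simp
    · intro p _ hp
      rw [h.other p hp, h.other p hp, hm _ _ hl (by lia)]
      simp
    · simp
  have hzero : ∀ l, l ≠ i → n' l = 0 := by
    have hex : ∃ m, ∀ l k, l ≠ i → m ≤ k → δ k (n' l) = 0 := by
      choose m hm using fun l => h.eventually (n' l)
      exact ⟨∑ l, m l, fun l k _ hk => hm l k
        ((Finset.single_le_sum (fun _ _ => Nat.zero_le _) (Finset.mem_univ l)).trans hk)⟩
    obtain ⟨m, hm⟩ := hex
    have : ∀ d k, m ≤ k + d → ∀ l, l ≠ i → δ k (n' l) = 0 := by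
      intro d
      induction d with
      | zero => exact fun k hk l hl => hm l k hl hk
      | succ d ih => exact fun k hk => key k fun l q hl hq => ih q (by lia) l hl
    intro l hl
    rw [← h.zero (n' l)]
    exact this m 0 (by simp) l hl
  have hi : n' i = 0 := by
    -- Only `S_j S_i n'_i - 2 S_i S_j n'_i` is left in row `j`. Its coefficient of `t` is `-S_j (n'
    -- i)`, and `S_j` is injective.
    have e := congrArg (δ 1) (congrFun hn'0 j)
    rw [ymD2_apply, hzero j hj, Finset.sum_eq_single (s := Finset.univ) (f := fun p => _ - _) i] at e
    · simp only [map_zero, Finset.sum_const_zero, zero_add, Pi.zero_apply, map_sub, map_zsmul] at e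
      rw [h.other j hj, h.same, h.same, h.other j hj, h.other j hj, hb] at e
      simp only [map_zero, zero_add, two_smul, h.zero] at e
      apply h'.injective
      rw [map_zero]
      have e2 : S j (n' i) - (S j (n' i) + S j (n' i)) = - S j (n' i) := by abel
      rw [e2] at e
      simpa using e
    · intro p _ hp
      rw [hzero p hp]; simp
    · simp
  refine ⟨b, ?_⟩
  funext l
  have : n' l = 0 := by
    by_cases hl : l = i
    · rw [hl, hi]
    · exact hzero l hl
  exact (sub_eq_zero.1 this).symm

end DegreeSystem

end Complex

/-! ### The Yang–Mills algebra by its universal property, and the shift of one generator -/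

open Polynomial in
/-- `A` is the algebra generated by the `x_i` with the cubic Yang–Mills relations for the standard
metric. -/
structure IsYangMills {ι : Type} [Fintype ι] {A : Type} [Ring A] [Algebra ℂ A] (x : ι → A) :
    Prop where
  rel : YangMillsRel x
  adjoin_eq_top : Algebra.adjoin ℂ (Set.range x) = ⊤
  exists_lift (S : Type) [Ring S] [Algebra ℂ S] (y : ι → S) (hy : YangMillsRel y) :
    ∃ f : A →ₐ[ℂ] S, ∀ i, f (x i) = y i

namespace IsYangMills

variable {ι : Type} [Fintype ι] {A : Type} [Ring A] [Algebra ℂ A] {x : ι → A}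

theorem induction (hx : IsYangMills x) {p : A → Prop} (gen : ∀ i, p (x i))
    (algebraMap : ∀ c : ℂ, p (algebraMap ℂ A c)) (add : ∀ a b, p a → p b → p (a + b))
    (mul : ∀ a b, p a → p b → p (a * b)) (a : A) : p a := by
  have ha : a ∈ Algebra.adjoin ℂ (Set.range x) := by rw [hx.adjoin_eq_top]; trivial
  induction ha using Algebra.adjoin_induction with
  | mem a h => obtain ⟨i, rfl⟩ := h; exact gen i
  | algebraMap c => exact algebraMap c
  | add a b _ _ ha hb => exact add a b ha hb
  | mul a b _ _ ha hb => exact mul a b ha hb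

theorem op (hx : IsYangMills x) : IsYangMills (fun i => MulOpposite.op (x i)) where
  rel := hx.rel.op
  adjoin_eq_top := by
    rw [eq_top_iff]
    intro a _
    have : ∀ b : A, MulOpposite.op b ∈
        Algebra.adjoin ℂ (Set.range fun i => MulOpposite.op (x i)) := by
      refine hx.induction (fun i => Algebra.subset_adjoin ⟨i, rfl⟩)
        (fun c => Subalgebra.algebraMap_mem _ c) (fun a b ha hb => ?_) (fun a b ha hb => ?_)
      · rw [MulOpposite.op_add]; exact add_mem ha hb
      · rw [MulOpposite.op_mul]; exact mul_mem hb ha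
    exact this a.unop
  exists_lift S _ _ y hy := by
    obtain ⟨f, hf⟩ := hx.exists_lift Sᵐᵒᵖ (fun i => MulOpposite.op (y i)) hy.op
    exact ⟨AlgHom.opComm f, fun i => by simp [hf]⟩

-- The family with `-t` in place `i` and `0` elsewhere is commutative, so it satisfies the
-- relations; it is central in `A[t]` and may be subtracted from the generators.
open Polynomial in
theorem exists_shift (hx : IsYangMills x) (i : ι) : ∃ Δ : A →ₐ[ℂ] A[X],
    Δ (x i) = C (x i) + X ∧ ∀ j, j ≠ i → Δ (x j) = C (x j) := by
  classical
  have hz : YangMillsRel (fun j => if j = i then (-X : A[X]) else 0) := by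
    intro n
    refine Finset.sum_eq_zero fun l _ => ?_
    have : ⁅(if l = i then (-X : A[X]) else 0), (if n = i then (-X : A[X]) else 0)⁆ = 0 := by
      split_ifs <;> simp [Ring.lie_def]
    rw [this, Ring.lie_def, mul_zero, zero_mul, sub_zero]
  have hy := (hx.rel.map (C : A →+* A[X])).sub_of_commute hz fun j k => by
    split_ifs
    · exact (commute_X _).symm.neg_right
    · exact Commute.zero_right _
  obtain ⟨Δ, h⟩ := hx.exists_lift A[X] _ hy
  refine ⟨Δ, ?_, fun j hj => ?_⟩
  · rw [h]; simp
  · rw [h]; simp [hj]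

section Shift

open Polynomial

variable {i : ι} {Δ : A →ₐ[ℂ] A[X]}

/-- The coefficient of `t^k` in `Δ`. -/
def shiftCoeff (Δ : A →ₐ[ℂ] A[X]) (k : ℕ) : A →ₗ[ℂ] A :=
  ((lcoeff A k).restrictScalars ℂ) ∘ₗ Δ.toLinearMap

theorem shiftCoeff_apply (k : ℕ) (a : A) : shiftCoeff Δ k a = (Δ a).coeff k := rfl

theorem shiftCoeff_zero (hx : IsYangMills x) (hi : Δ (x i) = C (x i) + X)
    (hj : ∀ j, j ≠ i → Δ (x j) = C (x j)) (a : A) : shiftCoeff Δ 0 a = a := by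
  induction a using hx.induction with
  | gen j =>
    rw [shiftCoeff_apply]
    by_cases h : j = i
    · subst h; rw [hi]; simp
    · rw [hj j h]; simp
  | algebraMap c =>
    rw [shiftCoeff_apply, AlgHom.commutes, Polynomial.algebraMap_apply, coeff_C_zero]
  | add a b ha hb => rw [map_add, ha, hb]
  | mul a b ha hb => rw [shiftCoeff_apply] at *; rw [map_mul, mul_coeff_zero, ha, hb]

/-- Elimination of `x_i`: modulo the left ideal `A x_i`, every element is congruent to one that the
shift fixes. -/
theorem exists_decomp (hx : IsYangMills x) (hi : Δ (x i) = C (x i) + X)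
    (hj : ∀ j, j ≠ i → Δ (x j) = C (x j)) (a : A) : ∃ b c, a = c + b * x i ∧ Δ c = C c := by
  -- Quantifying over all decomposable `p` makes the property of `a` stable under products.
  suffices ∀ a p : A, (∃ b c, p = c + b * x i ∧ Δ c = C c) →
      ∃ b c, a * p = c + b * x i ∧ Δ c = C c by
    obtain ⟨b, c, h, h'⟩ := this a 1 ⟨0, 1, by simp, by simp⟩
    exact ⟨b, c, by rw [← h, mul_one], h'⟩
  refine hx.induction ?_ ?_ ?_ ?_
  · rintro j p ⟨b, c, rfl, h⟩
    by_cases hji : j = i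
    · subst hji
      -- The commutator of `x_i` with an invariant `c` is again invariant, since `t` is central.
      refine ⟨c + x j * b, x j * c - c * x j, by noncomm_ring, ?_⟩
      rw [map_sub, map_mul, map_mul, hi, h, add_mul, mul_add, X_mul_C, C_sub, C_mul, C_mul]
      abel
    · refine ⟨x j * b, x j * c, by noncomm_ring, ?_⟩
      rw [map_mul, hj j hji, h, C_mul]
  · rintro r p ⟨b, c, rfl, h⟩
    refine ⟨algebraMap ℂ A r * b, algebraMap ℂ A r * c, by noncomm_ring, ?_⟩
    rw [map_mul, h, AlgHom.commutes, C_mul, Polynomial.algebraMap_apply]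
  · intro a b ha hb p hp
    obtain ⟨b₁, c₁, h₁, h₁'⟩ := ha p hp
    obtain ⟨b₂, c₂, h₂, h₂'⟩ := hb p hp
    refine ⟨b₁ + b₂, c₁ + c₂, by rw [add_mul, h₁, h₂]; noncomm_ring, ?_⟩
    rw [map_add, h₁', h₂', C_add]
  · intro a b ha hb p hp
    rw [mul_assoc]
    exact ha _ (hb p hp)

end Shift

/-! ### The resolution of a module -/

section Resolution

variable (M : Type) [AddCommGroup M] [Module A M] [Module ℂ M] [IsScalarTower ℂ A M]

/-- Right multiplications on the left factor of `A ⊗ M`. -/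
def tensorRight : Aᵐᵒᵖ →+* Module.End A (A ⊗[ℂ] M) where
  toFun a := TensorProduct.AlgebraTensorModule.map (LinearMap.toSpanSingleton A A a.unop)
    (LinearMap.id : M →ₗ[ℂ] M)
  map_one' := by ext; simp
  map_mul' a b := by ext; simp
  map_zero' := by ext; simp
  map_add' a b := by ext; simp [mul_add, TensorProduct.add_tmul]

/-- The action on the right factor of `A ⊗ M`. -/
def tensorLeft : A →+* Module.End A (A ⊗[ℂ] M) where
  toFun a := TensorProduct.AlgebraTensorModule.map (LinearMap.id : A →ₗ[A] A)
    (Algebra.lsmul ℂ ℂ M a)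
  map_one' := by ext; simp
  map_mul' a b := by ext; simp
  map_zero' := by ext; simp
  map_add' a b := by ext; simp [TensorProduct.tmul_add]

variable (x) in
/-- The operators `a ⊗ m ↦ a x_i ⊗ m - a ⊗ x_i m`. -/
def tensorOp (i : ι) : Module.End A (A ⊗[ℂ] M) :=
  tensorRight M (MulOpposite.op (x i)) - tensorLeft M (x i)

variable {M}

theorem tensorOp_tmul (i : ι) (a : A) (m : M) :
    tensorOp x M i (a ⊗ₜ m) = (a * x i) ⊗ₜ m - a ⊗ₜ (x i • m) := by
  simp [tensorOp, tensorRight, tensorLeft]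

variable (M) in
theorem commute_tensorRight_tensorLeft (a : Aᵐᵒᵖ) (b : A) :
    Commute (tensorRight M a) (tensorLeft M b) := by
  refine TensorProduct.AlgebraTensorModule.ext fun c m => ?_
  simp [tensorRight, tensorLeft]

variable (M) in
theorem tensorOp_rel (hx : IsYangMills x) : YangMillsRel (tensorOp x M) := by
  have h := hx.op.rel.map (T := Module.End A (A ⊗[ℂ] M)) (tensorRight M)
  have h' := hx.rel.map (T := Module.End A (A ⊗[ℂ] M)) (tensorLeft M)
  exact h.sub_of_commute h' fun i j => commute_tensorRight_tensorLeft M _ _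

-- The shift acts on the left factor of `A ⊗ M` only. There `S_i` multiplies by `x_i` on the right,
-- and its second term does not touch this factor, so the first four axioms can be read off on pure
-- tensors.
open Polynomial in
variable (M) in
theorem exists_degreeSystem (hx : IsYangMills x) (i : ι) :
    ∃ δ, DegreeSystem (tensorOp x M) i δ := by
  obtain ⟨Δ, hi, hj⟩ := hx.exists_shift i
  have hsame : ∀ k a, shiftCoeff Δ (k + 1) (a * x i) = shiftCoeff Δ (k + 1) a * x i +
      shiftCoeff Δ k a := fun k a => by
    simp only [shiftCoeff_apply, map_mul, hi, mul_add, coeff_add, coeff_mul_C, coeff_mul_X]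
  have hother : ∀ j, j ≠ i → ∀ k a, shiftCoeff Δ k (a * x j) = shiftCoeff Δ k a * x j :=
    fun j h k a => by simp only [shiftCoeff_apply, map_mul, hj j h, coeff_mul_C]
  refine ⟨fun k => ((shiftCoeff Δ k).rTensor M).toAddMonoidHom, ?_, ?_, ?_, ?_, ?_⟩
  · intro n
    have : shiftCoeff Δ 0 = LinearMap.id := by
      ext a; exact shiftCoeff_zero hx hi hj a
    simp [this]
  · intro n
    induction n using TensorProduct.induction_on with
    | zero => exact ⟨0, by simp⟩
    | tmul a m =>
      refine ⟨(Δ a).natDegree + 1, fun k hk => ?_⟩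
      simp [shiftCoeff_apply, coeff_eq_zero_of_natDegree_lt (Nat.lt_of_succ_le hk)]
    | add n n' h h' =>
      obtain ⟨m, hm⟩ := h
      obtain ⟨m', hm'⟩ := h'
      refine ⟨max m m', fun k hk => ?_⟩
      rw [map_add, hm k (le_of_max_le_left hk), hm' k (le_of_max_le_right hk), add_zero]
  · intro k n
    induction n using TensorProduct.induction_on with
    | zero => simp
    | tmul a m =>
      simp only [LinearMap.toAddMonoidHom_coe, tensorOp_tmul, map_sub, LinearMap.rTensor_tmul,
        hsame, TensorProduct.add_tmul]
      abel
    | add n n' h h' => simp only [map_add, h, h']; abel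
  · intro j h k n
    induction n using TensorProduct.induction_on with
    | zero => simp
    | tmul a m =>
      simp only [LinearMap.toAddMonoidHom_coe, tensorOp_tmul, map_sub, LinearMap.rTensor_tmul,
        hother j h]
    | add n n' h h' => simp only [map_add, h, h']
  -- Induction on a bound `d` for the degree of `a` in `t`. If `a = c + b x_i` with `c` invariant,
  -- then `a ⊗ m` is congruent to `c ⊗ m + b ⊗ x_i m` modulo the image of `S_i`, and `b` has smaller
  -- degree.
  · have key : ∀ (d : ℕ) (a : A) (m : M), (∀ k, d ≤ k → shiftCoeff Δ (k + 1) a = 0) →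
        ∃ b, ∀ k, (shiftCoeff Δ (k + 1)).rTensor M (a ⊗ₜ m - tensorOp x M i b) = 0 := by
      intro d
      induction d with
      | zero => exact fun a m h => ⟨0, fun k => by simp [h k]⟩
      | succ d ih =>
        intro a m h
        obtain ⟨b, c, rfl, hc⟩ := hx.exists_decomp hi hj a
        have hc' : ∀ k, shiftCoeff Δ (k + 1) c = 0 := fun k => by
          rw [shiftCoeff_apply, hc, coeff_C_succ]
        have hb : ∀ k, d ≤ k → shiftCoeff Δ (k + 1) b = 0 := by
          by_contra! hcon
          obtain ⟨k, hk, hne⟩ := hcon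
          obtain ⟨N, hN⟩ : ∃ N, ∀ k, N ≤ k → shiftCoeff Δ (k + 1) b = 0 :=
            ⟨(Δ b).natDegree, fun k hk =>
              coeff_eq_zero_of_natDegree_lt (Nat.lt_succ_of_le hk)⟩
          -- Descending from the degree of `Δ b`: the coefficient of `b x_i` in degree `k + 2` is
          -- `δ_{k+2}(b) x_i + δ_{k+1}(b)`.
          have hall : ∀ e k, d ≤ k → N ≤ k + e → shiftCoeff Δ (k + 1) b = 0 := by
            intro e
            induction e with
            | zero => exact fun k _ hk => hN k hk
            | succ e ihe =>
              intro k hk hk'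
              have := h (k + 1) (by lia)
              rwa [map_add, hc', hsame, ihe (k + 1) (by lia) (by lia), zero_mul, zero_add,
                zero_add] at this
          exact hne (hall N k hk (by lia))
        obtain ⟨b', hb'⟩ := ih b (x i • m) hb
        refine ⟨b ⊗ₜ m + b', fun k => ?_⟩
        have : (c + b * x i) ⊗ₜ[ℂ] m - tensorOp x M i (b ⊗ₜ m + b') =
            c ⊗ₜ m + (b ⊗ₜ (x i • m) - tensorOp x M i b') := by
          rw [map_add, tensorOp_tmul, TensorProduct.add_tmul]; abel
        rw [this, map_add, hb', LinearMap.rTensor_tmul, hc', TensorProduct.zero_tmul, add_zero]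
    intro n
    induction n using TensorProduct.induction_on with
    | zero => exact ⟨0, by simp⟩
    | tmul a m =>
      exact key (Δ a).natDegree a m fun k hk =>
        coeff_eq_zero_of_natDegree_lt (Nat.lt_succ_of_le hk)
    | add n n' h h' =>
      obtain ⟨b, hb⟩ := h
      obtain ⟨b', hb'⟩ := h'
      refine ⟨b + b', fun k => ?_⟩
      rw [map_add (tensorOp x M i), add_sub_add_comm, map_add, hb, hb', add_zero]

variable (M) in
theorem tensor_ymD3_injective [Nonempty ι] (hx : IsYangMills x) :
    Function.Injective (ymD3 (tensorOp x M)) :=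
  (hx.exists_degreeSystem M (Classical.arbitrary ι)).choose_spec.ymD3_injective

variable (M) in
theorem tensor_exact_ymD3_ymD2 [Nontrivial ι] (hx : IsYangMills x) :
    Function.Exact (ymD3 (tensorOp x M)) (ymD2 (tensorOp x M)) := by
  obtain ⟨i, j, hij⟩ := exists_pair_ne ι
  obtain ⟨δ, hδ⟩ := hx.exists_degreeSystem M i
  obtain ⟨δ', hδ'⟩ := hx.exists_degreeSystem M j
  exact hδ.exact_ymD3_ymD2 (tensorOp_rel M hx) hij.symm hδ'

end Resolution

end IsYangMills

namespace IsYangMills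

variable {ι : Type} [Fintype ι] {A : Type} [Ring A] [Algebra ℂ A] {x : ι → A}
section Resolution

variable (M : Type) [AddCommGroup M] [Module A M] [Module ℂ M] [IsScalarTower ℂ A M]

/-- The action map `a ⊗ m ↦ a m`. -/
def tensorAct : A ⊗[ℂ] M →ₗ[A] M where
  __ := TensorProduct.lift (Algebra.lsmul ℂ ℂ M : A →ₐ[ℂ] Module.End ℂ M).toLinearMap
  map_smul' a n := by
    induction n using TensorProduct.induction_on with
    | zero => simp
    | tmul b m => simp [TensorProduct.smul_tmul']
    | add n n' h h' => 
      simp only [smul_add] 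
      simp only [AddHom.toFun_eq_coe, LinearMap.coe_toAddHom, map_add, RingHom.id_apply] at h h' ⊢
      rw [h, h', smul_add]

variable {M}

theorem tensorAct_tmul (a : A) (m : M) : tensorAct M (a ⊗ₜ m) = a • m := rfl

theorem tensorAct_surjective : Function.Surjective (tensorAct (A := A) M) := fun m =>
  ⟨1 ⊗ₜ m, by rw [tensorAct_tmul, one_smul]⟩

-- Modulo boundaries `a ⊗ m` equals `1 ⊗ a m`: this holds for generators by the definition of `S_i`,
-- and it passes to products because `ab ⊗ m - 1 ⊗ abm = a (b ⊗ m - 1 ⊗ bm) + (a ⊗ bm - 1 ⊗ abm)`.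
variable (M) in
theorem exact_ymD1_tensorAct (hx : IsYangMills x) :
    Function.Exact (ymD1 (tensorOp x M)) (tensorAct M) := by
  classical
  have key : ∀ (a : A) (m : M), a ⊗ₜ m - 1 ⊗ₜ (a • m) ∈ LinearMap.range (ymD1 (tensorOp x M)) := by
    intro a
    induction a using hx.induction with
    | gen i =>
      intro m
      refine ⟨Pi.single i (1 ⊗ₜ m), ?_⟩
      rw [ymD1_apply, Finset.sum_eq_single i, Pi.single_eq_same, tensorOp_tmul, one_mul]
      · intro j _ hj
        rw [Pi.single_eq_of_ne hj, map_zero]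
      · simp
    | algebraMap c =>
      intro m
      rw [Algebra.algebraMap_eq_smul_one, TensorProduct.smul_tmul, smul_assoc, one_smul, sub_self]
      exact zero_mem _
    | add a b ha hb =>
      intro m
      rw [TensorProduct.add_tmul, add_smul, TensorProduct.tmul_add, add_sub_add_comm]
      exact add_mem (ha m) (hb m)
    | mul a b ha hb =>
      intro m
      have := add_mem (Submodule.smul_mem _ a (hb m)) (ha (b • m))
      rwa [smul_sub, TensorProduct.smul_tmul', TensorProduct.smul_tmul', smul_eq_mul, smul_eq_mul,
        mul_one, sub_add_sub_cancel, ← mul_smul] at this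
  have key2 : ∀ n : A ⊗[ℂ] M, n - 1 ⊗ₜ tensorAct M n ∈ LinearMap.range (ymD1 (tensorOp x M)) := by
    intro n
    induction n using TensorProduct.induction_on with
    | zero => simp
    | tmul a m => exact key a m
    | add n n' h h' =>
      rw [map_add, TensorProduct.tmul_add, add_sub_add_comm]
      exact add_mem h h'
  intro n
  refine ⟨fun hn => ?_, ?_⟩
  · have := key2 n
    rwa [hn, TensorProduct.tmul_zero, sub_zero] at this
  · rintro ⟨y, rfl⟩
    rw [ymD1_apply, map_sum]
    refine Finset.sum_eq_zero fun i _ => ?_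
    generalize y i = z
    induction z using TensorProduct.induction_on with
    | zero => simp
    | tmul a m => rw [tensorOp_tmul, map_sub, tensorAct_tmul, tensorAct_tmul, mul_smul, sub_self]
    | add n n' h h' => rw [map_add, map_add, h, h', add_zero]

/-- This is the Leibniz expansion of the `i`-th relation: in each of its words one letter at a time
is replaced by a basis vector, the letters before it acting on `A` and those after it on `M`. -/
theorem ymD2_single_one_tmul [DecidableEq ι] (i : ι) (m : M) :
    ymD2 (tensorOp x M) (Pi.single i (1 ⊗ₜ m)) = ∑ l,
      ((Pi.single i ((x l * x l) ⊗ₜ m) + Pi.single l (x l ⊗ₜ (x i • m)) +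
        Pi.single l (1 ⊗ₜ (x l • x i • m))) -
      (2 : ℤ) • (Pi.single l ((x l * x i) ⊗ₜ m) + Pi.single i (x l ⊗ₜ (x l • m)) +
        Pi.single l (1 ⊗ₜ (x i • x l • m))) +
      (Pi.single l ((x i * x l) ⊗ₜ m) + Pi.single l (x i ⊗ₜ (x l • m)) +
        Pi.single i (1 ⊗ₜ (x l • x l • m)))) := by
  have h : ∀ (j k : ι), tensorOp x M j (tensorOp x M k (1 ⊗ₜ m)) =
      (x k * x j) ⊗ₜ m - x k ⊗ₜ (x j • m) - x j ⊗ₜ (x k • m) + 1 ⊗ₜ (x j • x k • m) := by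
    intro j k
    rw [tensorOp_tmul, map_sub, tensorOp_tmul, tensorOp_tmul, one_mul, one_mul]
    abel
  funext j
  rw [ymD2_apply, Finset.sum_eq_single (s := Finset.univ) (f := fun p => _ - _) i]
  rotate_left
  · intro p _ hp
    rw [Pi.single_eq_of_ne hp]; simp
  · simp
  rw [Pi.single_eq_same, h, h]
  have hsum : ∀ f : ι → A ⊗[ℂ] M, ∑ l, (Pi.single l (f l) : ι → A ⊗[ℂ] M) j = f j := by
    intro f
    rw [← Finset.sum_apply, Finset.univ_sum_single]
  simp only [Finset.sum_apply, Pi.add_apply, Pi.sub_apply, Pi.smul_apply, Finset.sum_add_distrib,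
    Finset.sum_sub_distrib, ← Finset.smul_sum, hsum]
  by_cases hj : j = i
  · subst hj
    simp only [Pi.single_eq_same, h, Finset.sum_add_distrib, Finset.sum_sub_distrib]
    abel
  · simp only [Pi.single_eq_of_ne hj, map_zero, Finset.sum_const_zero]
    abel

-- Let `Q` be the cokernel of `ymD2`. On `Q × M`, let `x_i` act by `(q, m) ↦ (x_i q + u_i m, x_i
-- m)`, where `u_i m` is the class of `1 ⊗ m` in place `i`. The obstruction to the relations is the
-- class of a value of `ymD2`, so it vanishes and `A` acts on this extension. The action on `(0, m)`
-- then recovers the class of a cycle from its image under `ymD1`, which is zero.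
variable (M) in
theorem exact_ymD2_ymD1 (hx : IsYangMills x) :
    Function.Exact (ymD2 (tensorOp x M)) (ymD1 (tensorOp x M)) := by
  classical
  intro n
  refine ⟨fun hn => ?_, ?_⟩
  swap
  · rintro ⟨b, rfl⟩
    exact ymD1_ymD2 (tensorOp_rel M hx) b
  let Q := (ι → A ⊗[ℂ] M) ⧸ LinearMap.range (ymD2 (tensorOp x M))
  let π : (ι → A ⊗[ℂ] M) →ₗ[A] Q := Submodule.mkQ _
  let u (i : ι) : M →ₗ[ℂ] Q := (π.restrictScalars ℂ) ∘ₗ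
    (LinearMap.single ℂ (fun _ : ι => A ⊗[ℂ] M) i) ∘ₗ (TensorProduct.mk ℂ A M 1)
  have hu : ∀ i m, u i m = π (Pi.single i (1 ⊗ₜ m)) := fun _ _ => rfl
  let y (i : ι) : Module.End ℂ (Q × M) :=
    LinearMap.prod (Algebra.lsmul ℂ ℂ Q (x i) ∘ₗ LinearMap.fst ℂ Q M + u i ∘ₗ LinearMap.snd ℂ Q M)
      (Algebra.lsmul ℂ ℂ M (x i) ∘ₗ LinearMap.snd ℂ Q M)
  have hy : ∀ i q m, y i (q, m) = (x i • q + u i m, x i • m) := fun _ _ _ => rfl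
  have hsu : ∀ a i m, a • u i m = π (Pi.single i (a ⊗ₜ m)) := by
    intro a i m
    rw [hu, ← map_smul, ← Pi.single_smul, TensorProduct.smul_tmul', smul_eq_mul, mul_one]
  have hrel : YangMillsRel y := by
    rw [yangMillsRel_iff]
    intro i
    have hr := (yangMillsRel_iff x).1 hx.rel i
    refine LinearMap.ext fun qm => ?_
    obtain ⟨q, m⟩ := qm
    have hterm : ∀ l, (y l * y l * y i - 2 * (y l * y i * y l) + y i * y l * y l) (q, m) =
        ((x l * x l * x i - 2 * (x l * x i * x l) + x i * x l * x l) • q + π (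
          (Pi.single i ((x l * x l) ⊗ₜ m) + Pi.single l (x l ⊗ₜ (x i • m)) +
            Pi.single l (1 ⊗ₜ (x l • x i • m))) -
          (2 : ℤ) • (Pi.single l ((x l * x i) ⊗ₜ m) + Pi.single i (x l ⊗ₜ (x l • m)) +
            Pi.single l (1 ⊗ₜ (x i • x l • m))) +
          (Pi.single l ((x i * x l) ⊗ₜ m) + Pi.single l (x i ⊗ₜ (x l • m)) +
            Pi.single i (1 ⊗ₜ (x l • x l • m)))),
        (x l * x l * x i - 2 * (x l * x i * x l) + x i * x l * x l) • m) := by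
      intro l
      simp only [LinearMap.add_apply, LinearMap.sub_apply, Module.End.mul_apply, two_mul, hy,
        map_add, map_sub, ← hsu, one_smul, two_smul, add_smul, sub_smul, mul_smul,
        smul_add]
      ext
      · simp only [Prod.fst_add, Prod.fst_sub]
        abel
      · simp only [Prod.snd_add, Prod.snd_sub]
    rw [LinearMap.sum_apply, Finset.sum_congr rfl fun l _ => hterm l]
    ext
    · rw [Prod.fst_sum, Finset.sum_add_distrib, ← Finset.sum_smul, hr, zero_smul, zero_add,
        ← map_sum, ← ymD2_single_one_tmul]
      exact (Submodule.Quotient.mk_eq_zero _).2 ⟨_, rfl⟩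
    · rw [Prod.snd_sum, ← Finset.sum_smul, hr, zero_smul]
      rfl
  obtain ⟨f, hf⟩ := hx.exists_lift _ y hrel
  have hfst : ∀ a q m, f a (q, m) = f a (0, m) + (a • q, 0) := by
    intro a
    induction a using hx.induction with
    | gen i => intro q m; rw [hf, hy, hy]; simp [add_comm]
    | algebraMap c =>
      intro q m
      rw [AlgHom.commutes, Module.algebraMap_end_apply, Module.algebraMap_end_apply]
      simp
    | add a b ha hb =>
      intro q m
      rw [map_add, LinearMap.add_apply, LinearMap.add_apply, ha, hb, add_smul,
        add_add_add_comm]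
      simp
    | mul a b ha hb =>
      intro q m
      rw [map_mul, Module.End.mul_apply, Module.End.mul_apply, hb, map_add, ha (b • q) 0]
      have : ((0, 0) : Q × M) = 0 := rfl
      rw [this, map_zero, zero_add, mul_smul]
  let F : A ⊗[ℂ] M →ₗ[ℂ] Q × M := TensorProduct.lift
    ((LinearMap.lcomp ℂ (Q × M) (LinearMap.inr ℂ Q M)) ∘ₗ f.toLinearMap)
  have hF : ∀ a m, F (a ⊗ₜ m) = f a (0, m) := fun _ _ => rfl
  -- Up to the zero second component, `F` composed with `ymD1` is thus the projection `π` onto `Q`.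
  have hFop : ∀ i z, F (tensorOp x M i z) = (π (Pi.single i z), 0) := by
    intro i z
    induction z using TensorProduct.induction_on with
    | zero => simp only [map_zero, Pi.single_zero]; rfl
    | tmul a m =>
      rw [tensorOp_tmul, map_sub, hF, hF, map_mul, Module.End.mul_apply, hf, hy, smul_zero,
        zero_add, hfst, hsu]
      abel
    | add z z' h h' => rw [map_add, map_add, h, h', Pi.single_add, map_add]; simp
  have hd1 := congrArg F hn
  rw [ymD1_apply, map_sum, Finset.sum_congr rfl fun i _ => hFop i (n i), map_zero] at hd1
  have := congrArg Prod.fst hd1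
  rw [Prod.fst_sum, ← map_sum, Finset.univ_sum_single] at this
  exact (Submodule.Quotient.mk_eq_zero _).1 this

end Resolution
end IsYangMills

/-! ### Global dimension -/

section ProjectiveDimension

open CategoryTheory

variable {A : Type u} [Ring A]

theorem hasProjectiveDimensionLT_iff_of_exact {X Y Z : Type u} [AddCommGroup X] [Module A X]
    [AddCommGroup Y] [Module A Y] [AddCommGroup Z] [Module A Z] [Module.Projective A Y]
    {f : X →ₗ[A] Y} {g : Y →ₗ[A] Z} (hf : Function.Injective f) (hfg : Function.Exact f g)
    (hg : Function.Surjective g) (n : ℕ) :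
    HasProjectiveDimensionLT (ModuleCat.of A Z) (n + 2) ↔
      HasProjectiveDimensionLT (ModuleCat.of A X) (n + 1) := by
  let S : ShortComplex (ModuleCat.{u} A) := ShortComplex.mk (ModuleCat.ofHom f) (ModuleCat.ofHom g)
    (by ext y; exact (hfg _).2 ⟨y, rfl⟩)
  have hS : S.ShortExact := ModuleCat.shortComplex_shortExact S hfg hf hg
  have : Projective S.X₂ := inferInstanceAs (Projective (ModuleCat.of A Y))
  exact hS.hasProjectiveDimensionLT_X₃_iff n this

variable {P₃ P₂ P₁ P₀ M : Type u} [AddCommGroup P₃] [Module A P₃] [AddCommGroup P₂] [Module A P₂]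
  [AddCommGroup P₁] [Module A P₁] [AddCommGroup P₀] [Module A P₀] [AddCommGroup M] [Module A M]
  [Module.Projective A P₃] [Module.Projective A P₂] [Module.Projective A P₁]
  [Module.Projective A P₀]
  {d₃ : P₃ →ₗ[A] P₂} {d₂ : P₂ →ₗ[A] P₁} {d₁ : P₁ →ₗ[A] P₀} {d₀ : P₀ →ₗ[A] M}

theorem hasProjectiveDimensionLT_iff_ker_of_exact (h₁ : Function.Exact d₁ d₀)
    (h₀ : Function.Surjective d₀) (n : ℕ) :
    HasProjectiveDimensionLT (ModuleCat.of A M) (n + 3) ↔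
      HasProjectiveDimensionLT (ModuleCat.of A (LinearMap.ker d₁)) (n + 1) := by
  have e₁ := hasProjectiveDimensionLT_iff_of_exact (LinearMap.ker d₀).injective_subtype
    (LinearMap.exact_subtype_ker_map d₀) h₀ (n + 1)
  have e₂ := hasProjectiveDimensionLT_iff_of_exact (LinearMap.ker d₁).injective_subtype
    (g := d₁.codRestrict (LinearMap.ker d₀) fun y => (h₁ _).2 ⟨y, rfl⟩)
    (fun y => by
      rw [← LinearMap.exact_subtype_ker_map d₁ y, Subtype.ext_iff]; rfl)
    (fun y => by
      obtain ⟨z, hz⟩ := (h₁ _).1 y.2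
      exact ⟨z, Subtype.ext hz⟩) n
  exact e₁.trans e₂

theorem hasProjectiveDimensionLT_four_of_exact (h₃ : Function.Injective d₃)
    (h₂₃ : Function.Exact d₃ d₂) (h₁₂ : Function.Exact d₂ d₁) (h₁ : Function.Exact d₁ d₀)
    (h₀ : Function.Surjective d₀) : HasProjectiveDimensionLT (ModuleCat.of A M) 4 := by
  rw [hasProjectiveDimensionLT_iff_ker_of_exact h₁ h₀ 1]
  rw [hasProjectiveDimensionLT_iff_of_exact h₃
    (g := d₂.codRestrict (LinearMap.ker d₁) fun y => (h₁₂ _).2 ⟨y, rfl⟩)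
    (fun y => by rw [← h₂₃ y, Subtype.ext_iff]; rfl)
    (fun y => by
      obtain ⟨z, hz⟩ := (h₁₂ _).1 y.2
      exact ⟨z, Subtype.ext hz⟩) 0]
  infer_instance

/-- Projective dimension below three makes the second syzygy `ker d₁` projective; then `P₂ → ker d₁`
splits, and so does its kernel `d₃`. -/
theorem exists_retraction_of_exact (h₃ : Function.Injective d₃)
    (h₂₃ : Function.Exact d₃ d₂) (h₁₂ : Function.Exact d₂ d₁) (h₁ : Function.Exact d₁ d₀)
    (h₀ : Function.Surjective d₀) (h : HasProjectiveDimensionLT (ModuleCat.of A M) 3) :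
    ∃ r : P₂ →ₗ[A] P₃, r ∘ₗ d₃ = LinearMap.id := by
  rw [hasProjectiveDimensionLT_iff_ker_of_exact h₁ h₀ 0, zero_add,
    ← projective_iff_hasProjectiveDimensionLT_one, ← IsProjective.iff_projective] at h
  have hex : Function.Exact d₃ (d₂.codRestrict (LinearMap.ker d₁) fun y => (h₁₂ _).2 ⟨y, rfl⟩) :=
    fun y => by rw [← h₂₃ y, Subtype.ext_iff]; rfl
  obtain ⟨l, hl⟩ := Module.projective_lifting_property
    (d₂.codRestrict (LinearMap.ker d₁) fun y => (h₁₂ _).2 ⟨y, rfl⟩) LinearMap.id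
    (fun y => by
      obtain ⟨z, hz⟩ := (h₁₂ _).1 y.2
      exact ⟨z, Subtype.ext hz⟩)
  have tfae := hex.split_tfae'
  have h' := (tfae.out 0 1).1 (And.intro h₃ (Exists.intro l hl))
  exact h'.2

end ProjectiveDimension

namespace IsYangMills

variable {ι : Type} [Fintype ι] {A : Type} [Ring A] [Algebra ℂ A] {x : ι → A}

theorem exists_augmentation (hx : IsYangMills x) : ∃ ε : A →ₐ[ℂ] ℂ, ∀ i, ε (x i) = 0 :=
  hx.exists_lift ℂ (fun _ => 0) fun _ => by simp [Ring.lie_def]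

theorem leftGlobalDimension_le (hx : IsYangMills x) [Nontrivial ι] :
    leftGlobalDimension A ≤ 3 := by
  refine iSup_le fun M => ?_
  let : Module ℂ M := Module.compHom M (algebraMap ℂ A)
  have : IsScalarTower ℂ A M := IsScalarTower.of_algebraMap_smul fun _ _ => rfl
  refine (CategoryTheory.projectiveDimension_le_iff M 3).2 ?_
  exact hasProjectiveDimensionLT_four_of_exact (hx.tensor_ymD3_injective M)
    (hx.tensor_exact_ymD3_ymD2 M) (hx.exact_ymD2_ymD1 M) (hx.exact_ymD1_tensorAct M)
    tensorAct_surjective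

/-- The trivial module attains the bound: its last differential has coefficients in the augmentation
ideal, so it has no retraction. -/
theorem le_leftGlobalDimension (hx : IsYangMills x) [Nontrivial ι] :
    3 ≤ leftGlobalDimension A := by
  classical
  obtain ⟨ε, hε⟩ := hx.exists_augmentation
  let : Module A ℂ := Module.compHom ℂ ε.toRingHom
  have hsmul : ∀ (a : A) (z : ℂ), a • z = ε a * z := fun _ _ => rfl
  have : IsScalarTower ℂ A ℂ := ⟨fun c a z => by simp [hsmul, mul_assoc]⟩
  refine le_trans ?_ (le_iSup _ (ModuleCat.of A ℂ))
  refine (CategoryTheory.projectiveDimension_ge_iff (ModuleCat.of A ℂ) 3).2 fun h => ?_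
  obtain ⟨r, hr⟩ := exists_retraction_of_exact (hx.tensor_ymD3_injective ℂ)
    (hx.tensor_exact_ymD3_ymD2 ℂ) (hx.exact_ymD2_ymD1 ℂ) (hx.exact_ymD1_tensorAct ℂ)
    tensorAct_surjective h
  have h1 : ymD3 (tensorOp x ℂ) (1 ⊗ₜ 1) = ∑ i, x i • Pi.single i ((1 : A) ⊗ₜ[ℂ] (1 : ℂ)) := by
    funext i
    rw [ymD3_apply, tensorOp_tmul, hsmul, hε, zero_mul, TensorProduct.tmul_zero, sub_zero,
      Finset.sum_apply, Finset.sum_eq_single i]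
    · simp [TensorProduct.smul_tmul']
    · intro j _ hj
      rw [Pi.smul_apply, Pi.single_eq_of_ne hj.symm, smul_zero]
    · simp
  -- Composing the retraction with the action on `ℂ` kills every `x_i • _`, whereas the identity
  -- would give `1`.
  have h2 := congrArg (tensorAct ℂ) (LinearMap.congr_fun hr ((1 : A) ⊗ₜ[ℂ] (1 : ℂ)))
  rw [LinearMap.comp_apply, h1, LinearMap.id_apply, tensorAct_tmul, one_smul, map_sum, map_sum,
    Finset.sum_eq_zero] at h2
  · exact zero_ne_one h2
  · intro i _
    rw [map_smul, map_smul, hsmul, hε, zero_mul]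

theorem leftGlobalDimension_eq (hx : IsYangMills x) [Nontrivial ι] : leftGlobalDimension A = 3 :=
  le_antisymm hx.leftGlobalDimension_le hx.le_leftGlobalDimension

/-! ### The resolution of the trivial module -/

variable (x) in
/-- Right multiplication by `x_i`. -/
def rightMul (i : ι) : Module.End A A := LinearMap.toSpanSingleton A A (x i)

theorem rightMul_apply (i : ι) (a : A) : rightMul x i a = a * x i := rfl

/-- For `M = ℂ` the second term of `S_i` is zero, and under `A ⊗ ℂ ≃ A` the operator becomes right
multiplication by `x_i`. -/
theorem exact_augmentation (hx : IsYangMills x) [Nontrivial ι] {ε : A →ₐ[ℂ] ℂ}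
    (hε : ∀ i, ε (x i) = 0) :
    Function.Injective (ymD3 (rightMul x)) ∧ Function.Exact (ymD3 (rightMul x)) (ymD2 (rightMul x)) ∧
    Function.Exact (ymD2 (rightMul x)) (ymD1 (rightMul x)) ∧
    Function.Exact (ymD1 (rightMul x)) ε := by
  let : Module A ℂ := Module.compHom ℂ ε.toRingHom
  have hsmul : ∀ (a : A) (z : ℂ), a • z = ε a * z := fun _ _ => rfl
  have : IsScalarTower ℂ A ℂ := ⟨fun c a z => by simp [hsmul, mul_assoc]⟩
  let e : A ⊗[ℂ] ℂ ≃ₗ[A] A := TensorProduct.AlgebraTensorModule.rid ℂ A A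
  have he : ∀ i z, e (tensorOp x ℂ i z) = rightMul x i (e z) := by
    intro i z
    induction z using TensorProduct.induction_on with
    | zero => simp
    | tmul a z => 
      rw [tensorOp_tmul, hsmul, hε, zero_mul, TensorProduct.tmul_zero, sub_zero]
      simp [e, rightMul_apply]
    | add z z' h h' => simp only [map_add, h, h']
  let e' : (ι → A ⊗[ℂ] ℂ) ≃ₗ[A] (ι → A) := LinearEquiv.piCongrRight fun _ => e
  have h3 : ymD3 (rightMul x) ∘ₗ e.toLinearMap = e'.toLinearMap ∘ₗ ymD3 (tensorOp x ℂ) := by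
    exact LinearMap.ext fun z => funext fun i => (he i z).symm
  have h2 : ymD2 (rightMul x) ∘ₗ e'.toLinearMap = e'.toLinearMap ∘ₗ ymD2 (tensorOp x ℂ) := by
    refine LinearMap.ext fun z => funext fun i => ?_
    have : ∀ z i, e' z i = e (z i) := fun _ _ => rfl
    simp only [LinearMap.comp_apply, LinearEquiv.coe_coe, this, ymD2_apply, he, map_add, map_sub,
      map_sum, map_zsmul]
  have h1 : ymD1 (rightMul x) ∘ₗ e'.toLinearMap = e.toLinearMap ∘ₗ ymD1 (tensorOp x ℂ) := by
    refine LinearMap.ext fun z => ?_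
    have : ∀ z i, e' z i = e (z i) := fun _ _ => rfl
    simp [this, ymD1_apply, he]
  have h0 : (LinearMap.toSpanSingleton A ℂ 1) ∘ₗ e.toLinearMap =
      (LinearMap.id : ℂ →ₗ[A] ℂ) ∘ₗ tensorAct ℂ := by
    refine LinearMap.ext fun z => ?_
    induction z using TensorProduct.induction_on with
    | zero => simp
    | tmul a z =>
      simp [e, tensorAct_tmul, hsmul, mul_comm]
    | add z z' h h' => simp only [map_add, h, h']
  refine ⟨?_, ?_, ?_, ?_⟩
  · have := e'.injective.comp (hx.tensor_ymD3_injective ℂ)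
    have h : ⇑(ymD3 (rightMul x)) = (e' ∘ ymD3 (tensorOp x ℂ)) ∘ e.symm := by
      funext z
      simpa using LinearMap.congr_fun h3 (e.symm z)
    rw [h]
    exact this.comp e.symm.injective
  · exact (Function.Exact.of_ladder_linearEquiv_of_exact h3 h2 (hx.tensor_exact_ymD3_ymD2 ℂ) :)
  · exact (Function.Exact.of_ladder_linearEquiv_of_exact h2 h1 (hx.exact_ymD2_ymD1 ℂ) :)
  · have := Function.Exact.of_ladder_linearEquiv_of_exact (e₃ := LinearEquiv.refl A ℂ) h1 h0
      (hx.exact_ymD1_tensorAct ℂ)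
    intro a
    rw [← this a, LinearMap.toSpanSingleton_apply, hsmul, mul_one]

end IsYangMills

/-! ### Presentations of homogeneous algebras -/

namespace HomogeneousAlgebra

section General

variable {K : Type u} [Field K] {E : Type v} [AddCommGroup E] [Module K E] {N : ℕ}
variable (R : Submodule K (⨂[K]^N E))

theorem mk_surjective : Function.Surjective (mk R) :=
  RingQuot.mkAlgHom_surjective K (HomogeneousRel R)

theorem mk_ι (e : E) : mk R (TensorAlgebra.ι K e) = gen R e := rfl

variable {R} in
theorem mk_toTensorAlgebra {t : ⨂[K]^N E} (ht : t ∈ R) :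
    mk R (TensorPower.toTensorAlgebra t) = 0 := by
  have : mk R (TensorPower.toTensorAlgebra t) = mk R 0 :=
    RingQuot.mkAlgHom_rel K (s := HomogeneousRel R) ⟨⟨t, ht, rfl⟩, rfl⟩
  rw [this, map_zero]

theorem exists_lift {S : Type*} [Ring S] [Algebra K S] (f : E →ₗ[K] S)
    (hf : ∀ t ∈ R, TensorAlgebra.lift K f (TensorPower.toTensorAlgebra t) = 0) :
    ∃ F : HomogeneousAlgebra R →ₐ[K] S, ∀ e, F (gen R e) = f e := by
  refine ⟨RingQuot.liftAlgHom K ⟨TensorAlgebra.lift K f, ?_⟩, fun e => ?_⟩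
  · rintro x y ⟨⟨t, ht, rfl⟩, rfl⟩
    rw [hf t ht, map_zero]
  · exact (RingQuot.liftAlgHom_mkAlgHom_apply K _ _ _).trans (TensorAlgebra.lift_ι_apply f e)

theorem adjoin_range_gen {ι : Type*} (b : Module.Basis ι K E) :
    Algebra.adjoin K (Set.range fun i => gen R (b i)) = ⊤ := by
  have hgen : ∀ e, gen R e ∈ Algebra.adjoin K (Set.range fun i => gen R (b i)) := by
    intro e
    induction b.mem_span e using Submodule.span_induction with
    | mem e h => obtain ⟨i, rfl⟩ := h; exact Algebra.subset_adjoin ⟨i, rfl⟩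
    | zero => rw [map_zero]; exact zero_mem _
    | add e e' _ _ h h' => rw [map_add]; exact add_mem h h'
    | smul c e _ h => rw [map_smul]; exact Subalgebra.smul_mem _ h c
  rw [eq_top_iff]
  intro a _
  obtain ⟨t, rfl⟩ := mk_surjective R a
  induction t using TensorAlgebra.induction with
  | algebraMap r => rw [AlgHom.commutes]; exact Subalgebra.algebraMap_mem _ r
  | ι e => exact hgen e
  | mul t t' h h' => rw [map_mul]; exact mul_mem (h trivial) (h' trivial)
  | add t t' h h' => rw [map_add]; exact add_mem (h trivial) (h' trivial)

end General

section Cubic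

variable {K : Type u} [Field K] {E : Type v} [AddCommGroup E] [Module K E]

theorem toTensorAlgebra_tprod_three (u v w : E) :
    TensorPower.toTensorAlgebra (PiTensorProduct.tprod K ![u, v, w]) =
      TensorAlgebra.ι K u * TensorAlgebra.ι K v * TensorAlgebra.ι K w := by
  rw [TensorPower.toTensorAlgebra_tprod, TensorAlgebra.tprod_apply]
  simp [List.ofFn_succ, mul_assoc]

variable {ι : Type*} [Fintype ι] (b : Module.Basis ι K E)

/-- The coordinates of a tensor in the dual basis are its pairings with the basis tensors. This
turns membership in `R^⊥` into linear equations on coefficients. -/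
theorem lift_toTensorAlgebra_dual {S : Type*} [Ring S] [Algebra K S]
    (f : Module.Dual K E →ₗ[K] S) (t : ⨂[K]^3 (Module.Dual K E)) :
    TensorAlgebra.lift K f (TensorPower.toTensorAlgebra t) =
      ∑ i, ∑ j, ∑ k, TensorPower.pairingDual K E 3 t (PiTensorProduct.tprod K ![b i, b j, b k]) •
        (f (b.coord i) * f (b.coord j) * f (b.coord k)) := by
  have hf : ∀ φ : Module.Dual K E, f φ = ∑ i, φ (b i) • f (b.coord i) := by
    intro φ
    simp only [← map_smul, ← map_sum]
    congr 1
    refine b.ext fun j => ?_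
    simp
  induction t using PiTensorProduct.induction_on with
  | smul_tprod r φ =>
    obtain ⟨u, v, w, rfl⟩ : ∃ u v w, φ = ![u, v, w] :=
      ⟨φ 0, φ 1, φ 2, by ext i; fin_cases i <;> rfl⟩
    simp only [map_smul, toTensorAlgebra_tprod_three, map_mul, TensorAlgebra.lift_ι_apply,
      LinearMap.smul_apply, TensorPower.pairingDual_tprod_tprod, Fin.prod_univ_three]
    rw [hf u, hf v, hf w, Finset.sum_mul_sum, Finset.sum_mul, Finset.smul_sum]
    refine Finset.sum_congr rfl fun i _ => ?_
    rw [Finset.sum_mul, Finset.smul_sum]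
    refine Finset.sum_congr rfl fun j _ => ?_
    rw [Finset.mul_sum, Finset.smul_sum]
    refine Finset.sum_congr rfl fun k _ => ?_
    simp [smul_smul, mul_assoc, mul_comm, mul_left_comm]
  | add t t' h h' =>
    simp only [map_add, h, h', LinearMap.add_apply, add_smul, Finset.sum_add_distrib]

end Cubic

/-! ### The relations in an orthonormal basis -/

section YangMills

variable {ι : Type} [Fintype ι] [DecidableEq ι] (b : Module.Basis ι ℂ (ι → ℂ))

/-- The coefficients `δ_{ij} δ_{kn} - 2 δ_{ik} δ_{jn} + δ_{jk} δ_{in}`. -/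
def ymCoeff (n i j k : ι) : ℂ :=
  (if i = j ∧ k = n then 1 else 0) - 2 * (if i = k ∧ j = n then 1 else 0) +
    (if j = k ∧ i = n then 1 else 0)

theorem sum_ymCoeff {M : Type*} [AddCommGroup M] [Module ℂ M] (n : ι) (f : ι → ι → ι → M) :
    ∑ i, ∑ j, ∑ k, ymCoeff n i j k • f i j k =
      ∑ l, (f l l n - (2 : ℂ) • f l n l + f n l l) := by
  have h1 : ∀ i j k, ymCoeff n i j k • f i j k = (if i = j then if k = n then f i j k else 0 else 0)
      - (2 : ℂ) • (if i = k then if j = n then f i j k else 0 else 0)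
      + (if i = n then if j = k then f i j k else 0 else 0) := by
    intro i j k
    rw [ymCoeff, add_smul, sub_smul, mul_smul]
    simp only [ite_smul, one_smul, zero_smul, ite_and]
    congr 1
    by_cases h : i = n <;> by_cases h' : j = k <;> simp [h, h']
  simp only [h1, Finset.sum_add_distrib, Finset.sum_sub_distrib, ← Finset.smul_sum]
  refine congrArg₂ (· + ·) (congrArg₂ (· - ·) ?_ (congrArg _ ?_)) ?_
  · refine Finset.sum_congr rfl fun i _ => ?_
    rw [Finset.sum_eq_single i (by intro j _ hj; simp [hj.symm]) (by simp)]
    simp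
  · refine Finset.sum_congr rfl fun i _ => ?_
    rw [Finset.sum_comm, Finset.sum_eq_single i (by intro j _ hj; simp [hj.symm]) (by simp)]
    simp
  · rw [Finset.sum_eq_single n (by intro j _ hj; simp [hj]) (by simp)]
    simp

/-- The tensor `∑_l (b_l b_l b_n - 2 b_l b_n b_l + b_n b_l b_l)`. -/
def ymTensor (n : ι) : ⨂[ℂ]^3 (ι → ℂ) :=
  ∑ l, (PiTensorProduct.tprod ℂ ![b l, b l, b n] - (2 : ℂ) • PiTensorProduct.tprod ℂ ![b l, b n, b l]
    + PiTensorProduct.tprod ℂ ![b n, b l, b l])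

theorem ymTensor_eq (n : ι) : ymTensor b n = ∑ i, ∑ j, ∑ k,
    ymCoeff n i j k • PiTensorProduct.tprod ℂ ![b i, b j, b k] :=
  (sum_ymCoeff n fun i j k => PiTensorProduct.tprod ℂ ![b i, b j, b k]).symm

variable {b} {R : Submodule ℂ (⨂[ℂ]^3 (ι → ℂ))}

theorem isYangMills_gen (hR : R = Submodule.span ℂ (Set.range (ymTensor b))) :
    IsYangMills fun i => gen R (b i) where
  rel := by
    rw [yangMillsRel_iff]
    intro n
    have h := mk_toTensorAlgebra (R := R) (t := ymTensor b n)
      (hR ▸ Submodule.subset_span ⟨n, rfl⟩)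
    rw [ymTensor, map_sum, map_sum] at h
    rw [← h]
    refine Finset.sum_congr rfl fun l _ => ?_
    simp only [map_add, map_sub, toTensorAlgebra_tprod_three, map_mul, mk_ι, two_smul,
      two_mul]
  adjoin_eq_top := adjoin_range_gen R b
  exists_lift S _ _ y hy := by
    obtain ⟨F, hF⟩ := exists_lift R (b.constr ℂ y) fun t ht => by
      rw [hR] at ht
      induction ht using Submodule.span_induction with
      | mem t h =>
        obtain ⟨n, rfl⟩ := h
        rw [ymTensor, map_sum, map_sum, ← (yangMillsRel_iff y).1 hy n]
        refine Finset.sum_congr rfl fun l _ => ?_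
        simp only [map_add, map_sub, toTensorAlgebra_tprod_three, map_mul,
          TensorAlgebra.lift_ι_apply, Module.Basis.constr_basis, two_smul, two_mul]
      | zero => simp
      | add t t' _ _ h h' => rw [map_add, map_add, h, h', add_zero]
      | smul c t _ h => rw [map_smul, map_smul, h, smul_zero]
    exact ⟨F, fun i => by rw [hF, Module.Basis.constr_basis]⟩

variable (b R) in
/-- The generators of the dual algebra. -/
def dualGen (i : ι) : HomogeneousAlgebra (perp R) := gen (perp R) (b.coord i)

theorem sum_smul_dualGen (hR : R = Submodule.span ℂ (Set.range (ymTensor b))) (c : ι → ι → ι → ℂ)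
    (hc : ∀ n, ∑ i, ∑ j, ∑ k, ymCoeff n i j k * c i j k = 0) :
    ∑ i, ∑ j, ∑ k, c i j k • (dualGen b R i * dualGen b R j * dualGen b R k) = 0 := by
  let t : ⨂[ℂ]^3 (Module.Dual ℂ (ι → ℂ)) := ∑ i, ∑ j, ∑ k,
    c i j k • PiTensorProduct.tprod ℂ ![b.coord i, b.coord j, b.coord k]
  have hpair : ∀ i j k, TensorPower.pairingDual ℂ (ι → ℂ) 3 t
      (PiTensorProduct.tprod ℂ ![b i, b j, b k]) = c i j k := by
    intro i j k
    simp only [t, map_sum, map_smul, LinearMap.sum_apply, LinearMap.smul_apply,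
      TensorPower.pairingDual_tprod_tprod, Fin.prod_univ_three]
    simp [Finsupp.single_apply]
  have ht : t ∈ perp R := by
    rw [perp, Submodule.mem_comap, Submodule.mem_dualAnnihilator, hR]
    intro z hz
    induction hz using Submodule.span_induction with
    | mem z h =>
      obtain ⟨n, rfl⟩ := h
      rw [ymTensor_eq]
      simp only [map_sum, map_smul, hpair, smul_eq_mul, hc]
    | zero => simp
    | add t t' _ _ h h' => rw [map_add, h, h', add_zero]
    | smul c t _ h => rw [map_smul, h, smul_zero]
  have h := mk_toTensorAlgebra ht
  simp only [t, map_sum, map_smul, toTensorAlgebra_tprod_three, map_mul, mk_ι] at h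
  exact h

theorem exists_dual_lift (hR : R = Submodule.span ℂ (Set.range (ymTensor b))) {S : Type*} [Ring S]
    [Algebra ℂ S] (y : ι → S)
    (hy : ∀ c : ι → ι → ι → ℂ, (∀ n, ∑ i, ∑ j, ∑ k, ymCoeff n i j k * c i j k = 0) →
      ∑ i, ∑ j, ∑ k, c i j k • (y i * y j * y k) = 0) :
    ∃ F : HomogeneousAlgebra (perp R) →ₐ[ℂ] S, ∀ i, F (dualGen b R i) = y i := by
  have hb : ∀ i, b.dualBasis i = b.coord i := fun i => by simp
  obtain ⟨F, hF⟩ := exists_lift (perp R) (b.dualBasis.constr ℂ y) fun t ht => by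
    rw [lift_toTensorAlgebra_dual b]
    simp only [← hb, Module.Basis.constr_basis]
    refine hy _ fun n => ?_
    rw [perp, Submodule.mem_comap, Submodule.mem_dualAnnihilator, hR] at ht
    rw [← ht _ (Submodule.subset_span ⟨n, rfl⟩), ymTensor_eq]
    simp only [map_sum, map_smul, smul_eq_mul]
  exact ⟨F, fun i => by rw [dualGen, hF, ← hb, Module.Basis.constr_basis]⟩

end YangMills

end HomogeneousAlgebra

/-! ### Linear forms on the dual algebra -/

namespace HomogeneousAlgebra

section YangMills

variable {ι : Type} [Fintype ι] [DecidableEq ι] {b : Module.Basis ι ℂ (ι → ℂ)}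
  {R : Submodule ℂ (⨂[ℂ]^3 (ι → ℂ))}

variable (b R) in
/-- The monomials in the generators of the dual algebra. -/
def dualWord (l : List ι) : HomogeneousAlgebra (perp R) := (l.map (dualGen b R)).prod

theorem dualWord_nil : dualWord b R [] = 1 := rfl

theorem dualWord_cons (i : ι) (l : List ι) :
    dualWord b R (i :: l) = dualGen b R i * dualWord b R l := rfl

theorem dualWord_append (l l' : List ι) :
    dualWord b R (l ++ l') = dualWord b R l * dualWord b R l' := by
  simp [dualWord]

theorem dualWord_three (i j k : ι) :
    dualWord b R [i, j, k] = dualGen b R i * dualGen b R j * dualGen b R k := by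
  simp [dualWord_cons, dualWord_nil, mul_assoc]

/-- The functions on words all of whose windows of three letters lie in the span of the `ymCoeff n`
form a space stable under `G ↦ G (· ++ [i])`. By orthogonality these operators satisfy the relations
of the dual algebra, which therefore acts; evaluation at the empty word gives the form. -/
theorem exists_dual_form (hR : R = Submodule.span ℂ (Set.range (ymTensor b))) (F : List ι → ℂ)
    (hF : ∀ u v, ∃ α : ι → ℂ, ∀ i j k, F (u ++ i :: j :: k :: v) = ∑ n, α n * ymCoeff n i j k) :
    ∃ g : HomogeneousAlgebra (perp R) →ₗ[ℂ] ℂ, ∀ l, g (dualWord b R l) = F l := by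
  let 𝓚 : Submodule ℂ (List ι → ℂ) :=
    { carrier := {F | ∀ u v, ∃ α : ι → ℂ, ∀ i j k,
        F (u ++ i :: j :: k :: v) = ∑ n, α n * ymCoeff n i j k}
      zero_mem' := fun u v => ⟨0, by simp⟩
      add_mem' := fun {F G} hF hG u v => by
        obtain ⟨α, hα⟩ := hF u v
        obtain ⟨β, hβ⟩ := hG u v
        exact ⟨α + β, fun i j k => by
          simp only [Pi.add_apply, hα, hβ, add_mul, Finset.sum_add_distrib]⟩
      smul_mem' := fun c F hF u v => by
        obtain ⟨α, hα⟩ := hF u v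
        exact ⟨c • α, fun i j k => by
          simp only [Pi.smul_apply, hα, smul_eq_mul, Finset.mul_sum, mul_assoc]⟩ }
  let y (i : ι) : Module.End ℂ 𝓚 :=
    (LinearMap.funLeft ℂ ℂ fun w : List ι => w ++ [i]).restrict fun F hF u v => by
      obtain ⟨α, hα⟩ := hF u (v ++ [i])
      exact ⟨α, fun j k l => by rw [← hα]; simp [LinearMap.funLeft_apply]⟩
  have hy : ∀ i (G : 𝓚) w, (y i G).1 w = G.1 (w ++ [i]) := fun _ _ _ => rfl
  obtain ⟨Φ, hΦ⟩ := exists_dual_lift hR y fun c hc => by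
    refine LinearMap.ext fun G => Subtype.ext (funext fun w => ?_)
    obtain ⟨α, hα⟩ := G.2 w []
    have h0 : ∑ n, α n * ∑ i, ∑ j, ∑ k, ymCoeff n i j k * c i j k = 0 := by simp [hc]
    simp only [LinearMap.sum_apply, LinearMap.smul_apply, Module.End.mul_apply,
      AddSubmonoidClass.coe_finsetSum, Finset.sum_apply, SetLike.val_smul, Pi.smul_apply, hy,
      List.append_assoc, List.cons_append, List.nil_append, hα, smul_eq_mul]
    refine Eq.trans ?_ h0
    simp only [Finset.mul_sum]
    symm
    rw [Finset.sum_comm]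
    refine Finset.sum_congr rfl fun i _ => ?_
    rw [Finset.sum_comm]
    refine Finset.sum_congr rfl fun j _ => ?_
    rw [Finset.sum_comm]
    exact Finset.sum_congr rfl fun k _ => Finset.sum_congr rfl fun n _ => by ring
  refine ⟨(LinearMap.proj [] ∘ₗ 𝓚.subtype) ∘ₗ LinearMap.applyₗ (⟨F, hF⟩ : 𝓚) ∘ₗ Φ.toLinearMap,
    fun l => ?_⟩
  have key : ∀ l w, (Φ (dualWord b R l) ⟨F, hF⟩).1 w = F (w ++ l) := by
    intro l
    induction l with
    | nil => intro w; simp [dualWord_nil]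
    | cons i l ih =>
      intro w
      rw [dualWord_cons, map_mul, Module.End.mul_apply, hΦ, hy, ih]
      simp
  exact key l []

theorem sum_mul_ymCoeff (α : ι → ℂ) (i j k : ι) : ∑ n, α n * ymCoeff n i j k =
    (if i = j then α k else 0) - 2 * (if i = k then α j else 0) + (if j = k then α i else 0) := by
  simp only [ymCoeff, mul_add, mul_sub, Finset.sum_add_distrib, Finset.sum_sub_distrib]
  congr 2
  · by_cases h : i = j <;> simp [h]
  · by_cases h : i = k <;> simp [h, mul_comm]
  · by_cases h : j = k <;> simp [h]

/-- Double annihilator: a functional separating the values of `g` from the span of the `ymCoeff n`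
would be the coefficient array of a relation in the dual algebra, and `g` vanishes on relations. -/
theorem exists_form_three (hR : R = Submodule.span ℂ (Set.range (ymTensor b)))
    (g : HomogeneousAlgebra (perp R) →ₗ[ℂ] ℂ) :
    ∃ α : ι → ℂ, ∀ i j k, g (dualWord b R [i, j, k]) = ∑ n, α n * ymCoeff n i j k := by
  let r (n : ι) : ι × ι × ι → ℂ := fun p => ymCoeff n p.1 p.2.1 p.2.2
  let v : ι × ι × ι → ℂ := fun p => g (dualWord b R [p.1, p.2.1, p.2.2])
  suffices v ∈ Submodule.span ℂ (Set.range r) by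
    obtain ⟨α, hα⟩ := (Submodule.mem_span_range_iff_exists_fun ℂ).1 this
    refine ⟨α, fun i j k => ?_⟩
    have := congrFun hα (i, j, k)
    simpa [r, v] using this.symm
  by_contra hv
  obtain ⟨φ, hφ, hle⟩ := Submodule.exists_le_ker_of_notMem hv
  have hφs : ∀ w : ι × ι × ι → ℂ, φ w = ∑ i, ∑ j, ∑ k, w (i, j, k) * φ (Pi.single (i, j, k) 1) := by
    intro w
    have hs : ∀ p : ι × ι × ι, (Pi.single p 1 : ι × ι × ι → ℂ) = fun q => if p = q then 1 else 0 :=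
      fun p => funext fun q => by simp [Pi.single_apply, eq_comm]
    rw [LinearMap.pi_apply_eq_sum_univ φ w, Fintype.sum_prod_type]
    simp only [Fintype.sum_prod_type, smul_eq_mul, hs]
  apply hφ
  have h := sum_smul_dualGen hR (fun i j k => φ (Pi.single (i, j, k) 1)) fun n => by
    have := hle (Submodule.subset_span ⟨n, rfl⟩)
    rwa [LinearMap.mem_ker, hφs] at this
  have h' := congrArg g h
  rw [hφs]
  simpa only [map_sum, map_smul, smul_eq_mul, map_zero, ← dualWord_three, mul_comm] using h'

theorem exists_form_four [Nontrivial ι] (hR : R = Submodule.span ℂ (Set.range (ymTensor b)))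
    (g : HomogeneousAlgebra (perp R) →ₗ[ℂ] ℂ) :
    ∃ c : ℂ, ∀ i j k l, g (dualWord b R [i, j, k, l]) = c * ymCoeff i j k l := by
  choose α hα using fun i => exists_form_three hR (g ∘ₗ LinearMap.mulLeft ℂ (dualGen b R i))
  choose β hβ using fun i => exists_form_three hR (g ∘ₗ LinearMap.mulRight ℂ (dualGen b R i))
  have hα' : ∀ i j k l, g (dualWord b R [i, j, k, l]) = ∑ n, α i n * ymCoeff n j k l :=
    fun i j k l => hα i j k l
  have hβ' : ∀ i j k l, g (dualWord b R [i, j, k, l]) = ∑ n, β l n * ymCoeff n i j k :=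
    fun i j k l => by
      rw [← hβ l i j k, LinearMap.comp_apply, LinearMap.mulRight_apply]
      congr 1
      simp [dualWord_cons, dualWord_nil, mul_assoc]
  -- The windows `jkl` and `ijk` give two expressions for the same value. The words `ppqq`, `pqqp`
  -- and `pppq` then force `α` to be a scalar matrix.
  have h : ∀ i j k l, (if j = k then α i l else 0) - 2 * (if j = l then α i k else 0) +
      (if k = l then α i j else 0) = (if i = j then β l k else 0) -
      2 * (if i = k then β l j else 0) + (if j = k then β l i else 0) := by
    intro i j k l
    rw [← sum_mul_ymCoeff, ← sum_mul_ymCoeff, ← hα', hβ']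
  have h1 : ∀ p q, p ≠ q → α p p = β q q := fun p q hpq => by
    simpa [hpq, hpq.symm] using h p p q q
  have h2 : ∀ p q, p ≠ q → α p p = β p p := fun p q hpq => by
    simpa [hpq, hpq.symm] using h p q q p
  have h3 : ∀ p q, p ≠ q → α p q = 0 := fun p q hpq => by
    have := h p p p q
    simp [hpq] at this
    linear_combination this
  have h4 : ∀ p q, α p p = α q q := fun p q => by
    by_cases hpq : p = q
    · rw [hpq]
    · rw [h1 p q hpq, h2 q p (Ne.symm hpq)]
  obtain ⟨o⟩ := (inferInstance : Nonempty ι)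
  have h5 : ∀ p q, α p q = if p = q then α o o else 0 := fun p q => by
    by_cases hpq : p = q
    · rw [if_pos hpq, hpq, h4]
    · rw [if_neg hpq, h3 p q hpq]
  refine ⟨α o o, fun i j k l => ?_⟩
  rw [hα', sum_mul_ymCoeff, h5 i l, h5 i k, h5 i j, ymCoeff]
  simp only [ite_and, @eq_comm _ l i, @eq_comm _ k i, @eq_comm _ j i]
  split_ifs <;> ring

theorem form_five [Nontrivial ι] (hR : R = Submodule.span ℂ (Set.range (ymTensor b)))
    (g : HomogeneousAlgebra (perp R) →ₗ[ℂ] ℂ) (i j k l m : ι) :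
    g (dualWord b R [i, j, k, l, m]) = 0 := by
  obtain ⟨c, hc⟩ := exists_form_four hR (g ∘ₗ LinearMap.mulLeft ℂ (dualGen b R i))
  choose c' hc' using fun i =>
    exists_form_four hR (g ∘ₗ LinearMap.mulRight ℂ (dualGen b R i))
  have hl : ∀ j k l m, g (dualWord b R [i, j, k, l, m]) = c * ymCoeff j k l m := hc
  have hr : ∀ j k l m, g (dualWord b R [i, j, k, l, m]) = c' m * ymCoeff i j k l :=
    fun j k l m => by
      rw [← hc', LinearMap.comp_apply, LinearMap.mulRight_apply]
      congr 1
      simp [dualWord_cons, dualWord_nil, mul_assoc]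
  obtain ⟨q, hq⟩ := exists_ne i
  have h : c = 0 := by
    -- On the word `iiiqq` the last four letters give `c`, the first four give zero.
    have := (hl i i q q).symm.trans (hr i i q q)
    simpa [ymCoeff, hq, hq.symm] using this
  rw [hl, h, zero_mul]

end YangMills

end HomogeneousAlgebra

/-! ### The components of the dual algebra -/

namespace HomogeneousAlgebra

section YangMills

variable {ι : Type} [Fintype ι] [DecidableEq ι] {b : Module.Basis ι ℂ (ι → ℂ)}
  {R : Submodule ℂ (⨂[ℂ]^3 (ι → ℂ))}

variable (b R) in
theorem dualComponent_eq_span (n : ℕ) : dualComponent R n =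
    Submodule.span ℂ (dualWord b R '' {l | l.length = n}) := by
  have hrange : LinearMap.range (gen (perp R)) = Submodule.span ℂ (Set.range (dualGen b R)) := by
    have : Set.range (dualGen b R) = gen (perp R) '' Set.range b.dualBasis := by
      rw [← Set.range_comp]
      congr 1
      funext i
      simp [dualGen]
    rw [this, ← Submodule.map_span, b.dualBasis.span_eq, Submodule.map_top]
  induction n with
  | zero =>
    have : {l : List ι | l.length = 0} = {[]} := by ext l; simp
    rw [this, Set.image_singleton, dualWord_nil, ← Submodule.one_eq_span]
    exact pow_zero _
  | succ n ih =>
    change LinearMap.range (gen (perp R)) ^ (n + 1) = _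
    rw [pow_succ']
    change _ * dualComponent R n = _
    rw [ih, hrange, Submodule.span_mul_span]
    congr 1
    ext z
    simp only [Set.mem_mul, Set.mem_range, Set.mem_image, Set.mem_ofPred_eq]
    constructor
    · rintro ⟨_, ⟨i, rfl⟩, _, ⟨l, hl, rfl⟩, rfl⟩
      exact ⟨i :: l, by simp [hl], rfl⟩
    · rintro ⟨_ | ⟨i, l⟩, hl, rfl⟩
      · simp at hl
      · exact ⟨_, ⟨i, rfl⟩, _, ⟨l, by simpa using hl, rfl⟩, rfl⟩

theorem domRestrict_eq {n : ℕ} {g g' : HomogeneousAlgebra (perp R) →ₗ[ℂ] ℂ}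
    (h : ∀ l : List ι, l.length = n → g (dualWord b R l) = g' (dualWord b R l)) :
    g.domRestrict (dualComponent R n) = g'.domRestrict (dualComponent R n) := by
  refine LinearMap.ext fun z => ?_
  obtain ⟨z, hz⟩ := z
  simp only [LinearMap.domRestrict_apply]
  rw [dualComponent_eq_span b] at hz
  induction hz using Submodule.span_induction with
  | mem z hz => obtain ⟨l, hl, rfl⟩ := hz; exact h l hl
  | zero => simp
  | add z z' _ _ h h' => rw [map_add, map_add, h, h']
  | smul c z _ h => rw [map_smul, map_smul, h]

theorem dualComponent_eq_bot [Nontrivial ι]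
    (hR : R = Submodule.span ℂ (Set.range (ymTensor b))) (n : ℕ) :
    dualComponent R (n + 5) = ⊥ := by
  rw [dualComponent_eq_span b, Submodule.span_eq_bot]
  rintro _ ⟨l, hl, rfl⟩
  obtain ⟨i, j, k, p, q, l, rfl⟩ : ∃ i j k p q l', l = [i, j, k, p, q] ++ l' := by
    rcases l with _ | ⟨i, _ | ⟨j, _ | ⟨k, _ | ⟨p, _ | ⟨q, l⟩⟩⟩⟩⟩ <;>
      simp at hl ⊢
  rw [dualWord_append, (Module.forall_dual_apply_eq_zero_iff ℂ (dualWord b R [i, j, k, p, q])).1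
    fun g => form_five hR g i j k p q, zero_mul]

theorem exists_form_domRestrict {n : ℕ} (f : Module.Dual ℂ (dualComponent R n)) :
    ∃ g : HomogeneousAlgebra (perp R) →ₗ[ℂ] ℂ, g.domRestrict (dualComponent R n) = f :=
  LinearMap.exists_extend f

variable (b R) in
/-- Linear forms on the dual algebra which restrict to bases of the duals of the components of
degree `0`, `1`, `3` and `4`. -/
structure IsDualForms (g₀ : HomogeneousAlgebra (perp R) →ₗ[ℂ] ℂ)
    (g₁ g₃ : ι → HomogeneousAlgebra (perp R) →ₗ[ℂ] ℂ)
    (g₄ : HomogeneousAlgebra (perp R) →ₗ[ℂ] ℂ) : Prop where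
  zero : g₀ (dualWord b R []) = 1
  one (i j : ι) : g₁ i (dualWord b R [j]) = if j = i then 1 else 0
  three (n i j k : ι) : g₃ n (dualWord b R [i, j, k]) = ymCoeff n i j k
  four (i j k l : ι) : g₄ (dualWord b R [i, j, k, l]) = ymCoeff i j k l

/-- Cyclic invariance is what makes the form of degree four admissible on its first window as well
as on its last. -/
theorem ymCoeff_rotate (i j k l : ι) : ymCoeff i j k l = ymCoeff l i j k := by
  simp only [ymCoeff, ite_and]
  split_ifs <;> grind

theorem exists_isDualForms (hR : R = Submodule.span ℂ (Set.range (ymTensor b))) :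
    ∃ g₀ g₁ g₃ g₄, IsDualForms b R g₀ g₁ g₃ g₄ := by
  obtain ⟨g₀, h₀⟩ := exists_dual_form hR (fun l => if l = [] then 1 else 0)
    fun u v => ⟨0, fun i j k => by simp⟩
  have h₁ : ∀ p : ι, ∃ g : HomogeneousAlgebra (perp R) →ₗ[ℂ] ℂ, ∀ l,
      g (dualWord b R l) = if l = [p] then 1 else 0 := fun p =>
    exists_dual_form hR _ fun u v => ⟨0, fun i j k => by
      rw [if_neg]
      · simp
      · intro h
        have := congrArg List.length h
        simp at this
        lia⟩
  have h₃ : ∀ n : ι, ∃ g : HomogeneousAlgebra (perp R) →ₗ[ℂ] ℂ, ∀ l, g (dualWord b R l) =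
      match l with
      | [i, j, k] => ymCoeff n i j k
      | _ => 0 := fun n =>
    exists_dual_form hR _ fun u v => by
      rcases u with _ | ⟨p, u⟩
      · rcases v with _ | ⟨q, v⟩
        · exact ⟨Pi.single n 1, fun i j k => by
            rw [Finset.sum_eq_single n (by intro m _ hm; simp [hm]) (by simp)]; simp⟩
        · exact ⟨0, by simp⟩
      · exact ⟨0, fun i j k => by
          rcases u with _ | ⟨q, _ | ⟨r, u⟩⟩ <;> simp⟩
  obtain ⟨g₄, h₄⟩ := exists_dual_form hR
    (fun l => match l with
      | [i, j, k, l] => ymCoeff i j k l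
      | _ => 0) fun u v => by
    rcases u with _ | ⟨p, u⟩
    · rcases v with _ | ⟨q, _ | ⟨r, v⟩⟩
      · exact ⟨0, by simp⟩
      · exact ⟨Pi.single q 1, fun i j k => by
          rw [Finset.sum_eq_single q (by intro m _ hm; simp [hm]) (by simp)]
          simp [ymCoeff_rotate i j k q]⟩
      · exact ⟨0, by simp⟩
    · rcases u with _ | ⟨q, u⟩
      · rcases v with _ | ⟨q, v⟩
        · exact ⟨Pi.single p 1, fun i j k => by
            rw [Finset.sum_eq_single p (by intro m _ hm; simp [hm]) (by simp)]; simp⟩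
        · exact ⟨0, by simp⟩
      · exact ⟨0, fun i j k => by
          rcases u with _ | ⟨r, _ | ⟨t, u⟩⟩ <;> simp⟩
  choose g₁ h₁ using h₁
  choose g₃ h₃ using h₃
  exact ⟨g₀, g₁, g₃, g₄, by simp [h₀], by simp [h₁], by simp [h₃], by simp [h₄]⟩

namespace IsDualForms

variable {g₀ : HomogeneousAlgebra (perp R) →ₗ[ℂ] ℂ}
  {g₁ g₃ : ι → HomogeneousAlgebra (perp R) →ₗ[ℂ] ℂ} {g₄ : HomogeneousAlgebra (perp R) →ₗ[ℂ] ℂ}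

theorem exists_basis_zero (h : IsDualForms b R g₀ g₁ g₃ g₄) :
    ∃ β : Module.Basis Unit ℂ (Module.Dual ℂ (dualComponent R 0)),
      ∀ i, β i = g₀.domRestrict _ := by
  refine ⟨Module.Basis.mk (v := fun _ => g₀.domRestrict (dualComponent R 0)) ?_ ?_,
    fun i => Module.Basis.mk_apply _ _ i⟩
  · rw [linearIndependent_unique_iff]
    intro h0
    have := LinearMap.congr_fun h0 ⟨dualWord b R [], by
      rw [dualComponent_eq_span b]; exact Submodule.subset_span ⟨[], rfl, rfl⟩⟩
    simp [h.zero] at this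
  · rintro f -
    obtain ⟨g, rfl⟩ := exists_form_domRestrict f
    rw [Submodule.mem_span_range_iff_exists_fun]
    refine ⟨fun _ => g (dualWord b R []), ?_⟩
    simp only [Finset.univ_unique, Finset.sum_singleton]
    refine domRestrict_eq (b := b) (g := g (dualWord b R []) • g₀) fun l hl => ?_
    obtain rfl := List.length_eq_zero_iff.1 hl
    simp [h.zero]

theorem exists_basis_four [Nontrivial ι] (hR : R = Submodule.span ℂ (Set.range (ymTensor b)))
    (h : IsDualForms b R g₀ g₁ g₃ g₄) :
    ∃ β : Module.Basis Unit ℂ (Module.Dual ℂ (dualComponent R 4)),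
      ∀ i, β i = g₄.domRestrict _ := by
  refine ⟨Module.Basis.mk (v := fun _ => g₄.domRestrict (dualComponent R 4)) ?_ ?_,
    fun i => Module.Basis.mk_apply _ _ i⟩
  · rw [linearIndependent_unique_iff]
    intro h0
    obtain ⟨p, q, hpq⟩ := exists_pair_ne ι
    have := LinearMap.congr_fun h0 ⟨dualWord b R [p, p, q, q], by
      rw [dualComponent_eq_span b]; exact Submodule.subset_span ⟨_, rfl, rfl⟩⟩
    simp [h.four, ymCoeff, hpq, hpq.symm] at this
  · rintro f -
    obtain ⟨g, rfl⟩ := exists_form_domRestrict f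
    rw [Submodule.mem_span_range_iff_exists_fun]
    obtain ⟨c, hc⟩ := exists_form_four hR g
    refine ⟨fun _ => c, ?_⟩
    simp only [Finset.univ_unique, Finset.sum_singleton]
    refine domRestrict_eq (b := b) (g := c • g₄) fun l hl => ?_
    obtain ⟨i, j, k, p, rfl⟩ := List.length_eq_four.1 hl
    simp [h.four, hc]

theorem exists_basis_one (h : IsDualForms b R g₀ g₁ g₃ g₄) :
    ∃ β : Module.Basis ι ℂ (Module.Dual ℂ (dualComponent R 1)),
      ∀ i, β i = (g₁ i).domRestrict _ := by
  refine ⟨Module.Basis.mk (v := fun i => (g₁ i).domRestrict (dualComponent R 1)) ?_ ?_,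
    fun i => Module.Basis.mk_apply _ _ i⟩
  · rw [Fintype.linearIndependent_iff]
    intro c hc i
    have := LinearMap.congr_fun hc ⟨dualWord b R [i], by
      rw [dualComponent_eq_span b]; exact Submodule.subset_span ⟨_, rfl, rfl⟩⟩
    simpa [h.one] using this
  · rintro f -
    obtain ⟨g, rfl⟩ := exists_form_domRestrict f
    rw [Submodule.mem_span_range_iff_exists_fun]
    refine ⟨fun i => g (dualWord b R [i]), ?_⟩
    refine Eq.trans ?_ (domRestrict_eq (b := b) (g := ∑ i, g (dualWord b R [i]) • g₁ i)
      fun l hl => ?_)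
    · ext z; simp
    · obtain ⟨i, rfl⟩ := List.length_eq_one_iff.1 hl
      simp [h.one]

theorem exists_basis_three [Nontrivial ι] (hR : R = Submodule.span ℂ (Set.range (ymTensor b)))
    (h : IsDualForms b R g₀ g₁ g₃ g₄) :
    ∃ β : Module.Basis ι ℂ (Module.Dual ℂ (dualComponent R 3)),
      ∀ i, β i = (g₃ i).domRestrict _ := by
  refine ⟨Module.Basis.mk (v := fun i => (g₃ i).domRestrict (dualComponent R 3)) ?_ ?_,
    fun i => Module.Basis.mk_apply _ _ i⟩
  · rw [Fintype.linearIndependent_iff]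
    intro c hc i
    obtain ⟨q, hq⟩ := exists_ne i
    have := LinearMap.congr_fun hc ⟨dualWord b R [q, q, i], by
      rw [dualComponent_eq_span b]; exact Submodule.subset_span ⟨_, rfl, rfl⟩⟩
    simp only [LinearMap.sum_apply, LinearMap.smul_apply, LinearMap.domRestrict_apply, h.three,
      smul_eq_mul, sum_mul_ymCoeff] at this
    simpa [hq, hq.symm] using this
  · rintro f -
    obtain ⟨g, rfl⟩ := exists_form_domRestrict f
    rw [Submodule.mem_span_range_iff_exists_fun]
    obtain ⟨c, hc⟩ := exists_form_three hR g
    refine ⟨c, ?_⟩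
    refine Eq.trans ?_ (domRestrict_eq (b := b) (g := ∑ i, c i • g₃ i) fun l hl => ?_)
    · ext z; simp
    · obtain ⟨i, j, k, rfl⟩ := List.length_eq_three.1 hl
      simp [h.three, hc]

end IsDualForms

/-! ### The differentials of the Koszul complex in coordinates -/

/-- The element `∑ e_i ⊗ θ^i` does not depend on the basis, so the differential has the same shape
in the orthonormal one. -/
theorem koszulD_tmul (n : ℕ) (a : HomogeneousAlgebra R)
    (f : Module.Dual ℂ (dualComponent R (n + 1))) :
    koszulD R n (a ⊗ₜ f) = ∑ i, (a * gen R (b i)) ⊗ₜ (f ∘ₗ dualMul R (b.coord i) n) := by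
  have hval : ∀ θ (z : dualComponent R n), (dualMul R θ n z).1 = gen (perp R) θ * z.1 :=
    fun _ _ => rfl
  let D : Module.Dual ℂ (ι → ℂ) →ₗ[ℂ] Module.Dual ℂ (dualComponent R n) :=
    { toFun := fun θ => f ∘ₗ dualMul R θ n
      map_add' := fun θ θ' => by
        refine LinearMap.ext fun z => ?_
        have : dualMul R (θ + θ') n z = dualMul R θ n z + dualMul R θ' n z :=
          Subtype.ext (by simp only [Submodule.coe_add, hval, map_add, add_mul])
        simp only [LinearMap.comp_apply, this, map_add, LinearMap.add_apply]
      map_smul' := fun c θ => by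
        refine LinearMap.ext fun z => ?_
        have : dualMul R (c • θ) n z = c • dualMul R θ n z :=
          Subtype.ext (by simp only [Submodule.coe_smul, hval, map_smul, smul_mul_assoc])
        simp only [LinearMap.comp_apply, this, map_smul, LinearMap.smul_apply, RingHom.id_apply] }
  have hD : ∀ θ, f ∘ₗ dualMul R θ n = D θ := fun _ => rfl
  have h1 : koszulD R n (a ⊗ₜ f) = ∑ k, (a * gen R (Pi.single k 1)) ⊗ₜ D (LinearMap.proj k) := by
    rw [koszulD, LinearMap.sum_apply]
    rfl
  have hproj : ∀ k, (LinearMap.proj k : (ι → ℂ) →ₗ[ℂ] ℂ) = ∑ i, b i k • b.coord i := by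
    intro k
    refine b.ext fun j => ?_
    simp [Finsupp.single_apply]
  have hb : ∀ i, b i = ∑ k, b i k • (Pi.single k 1 : ι → ℂ) := fun i => by
    conv_lhs => rw [← Finset.univ_sum_single (b i)]
    refine Finset.sum_congr rfl fun k _ => ?_
    rw [← Pi.single_smul, smul_eq_mul, mul_one]
  rw [h1]
  simp only [hD]
  have h2 : ∀ i, (a * gen R (b i)) ⊗ₜ[ℂ] D (b.coord i) =
      ∑ k, (a * gen R (Pi.single k 1)) ⊗ₜ[ℂ] D (b i k • b.coord i) := by
    intro i
    conv_lhs => rw [hb i]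
    simp only [map_sum, map_smul, Finset.mul_sum, TensorProduct.sum_tmul, mul_smul_comm,
      TensorProduct.smul_tmul]
  rw [Finset.sum_congr rfl fun i _ => h2 i, Finset.sum_comm]
  refine Finset.sum_congr rfl fun k _ => ?_
  rw [hproj, map_sum, TensorProduct.tmul_sum]

theorem koszulD_tmul_domRestrict (n : ℕ) (a : HomogeneousAlgebra R)
    (g : HomogeneousAlgebra (perp R) →ₗ[ℂ] ℂ) :
    koszulD R n (a ⊗ₜ g.domRestrict (dualComponent R (n + 1))) = ∑ i, (a * gen R (b i)) ⊗ₜ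
      (g ∘ₗ LinearMap.mulLeft ℂ (dualGen b R i)).domRestrict (dualComponent R n) :=
  koszulD_tmul n a _

end YangMills

end HomogeneousAlgebra

/-! ### The Koszul complex in coordinates: acyclicity and length -/

theorem exists_equiv_tensor_of_basis {A : Type*} [Ring A] [Algebra ℂ A] {V : Type*} [AddCommGroup V]
    [Module ℂ V] {κ : Type*} [Fintype κ] (β : Module.Basis κ ℂ V) :
    ∃ e : (κ → A) ≃ₗ[A] A ⊗[ℂ] V, ∀ a, e a = ∑ i, a i ⊗ₜ β i :=
  ⟨(β.baseChange A).equivFun.symm, fun a => by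
    simp [Module.Basis.equivFun_symm_apply, TensorProduct.smul_tmul']⟩

theorem subsingleton_subquotient {A : Type u} [Ring A] {M : Type v} [AddCommGroup M] [Module A M]
    {Z B : Submodule A M} (h : Z ≤ B) : Subsingleton (Subquotient Z B) :=
  Submodule.Quotient.subsingleton_iff.2 (Submodule.submoduleOf_eq_top.2 h)

namespace HomogeneousAlgebra

open IsYangMills MulOpposite

theorem five_le_koszulIdx (n : ℕ) : 5 ≤ koszulIdx 3 (n + 4) := by
  induction n with
  | zero => decide
  | succ n ih => exact ih.trans (Nat.le_add_right _ _)

section YangMills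

variable {ι : Type} [Fintype ι] [DecidableEq ι] {b : Module.Basis ι ℂ (ι → ℂ)}
  {R : Submodule ℂ (⨂[ℂ]^3 (ι → ℂ))}

variable (b R) in
/-- Coordinates on the terms of the Koszul complex, in which its differentials are those of the
Yang–Mills complex. -/
structure KoszulCoordinates where
  e₀ : HomogeneousAlgebra R ≃ₗ[HomogeneousAlgebra R] KoszulTerm R 0
  e₁ : (ι → HomogeneousAlgebra R) ≃ₗ[HomogeneousAlgebra R] KoszulTerm R 1
  e₂ : (ι → HomogeneousAlgebra R) ≃ₗ[HomogeneousAlgebra R] KoszulTerm R 2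
  e₃ : HomogeneousAlgebra R ≃ₗ[HomogeneousAlgebra R] KoszulTerm R 3
  diff₀ (a) : koszulDiff R 0 (e₁ a) = e₀ (ymD1 (rightMul fun i => gen R (b i)) a)
  diff₁ (a) : koszulDiff R 1 (e₂ a) = e₁ (ymD2 (rightMul fun i => gen R (b i)) a)
  diff₂ (a) : koszulDiff R 2 (e₃ a) = e₂ (ymD3 (rightMul fun i => gen R (b i)) a)

theorem subsingleton_koszulTerm [Nontrivial ι]
    (hR : R = Submodule.span ℂ (Set.range (ymTensor b))) (n : ℕ) :
    Subsingleton (KoszulTerm R (n + 4)) := by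
  have h : ∀ m, 5 ≤ m → Subsingleton (KoszulModule R m) := by
    intro m hm
    obtain ⟨k, rfl⟩ := Nat.exists_eq_add_of_le' hm
    have : Subsingleton (dualComponent R (k + 5)) := by
      rw [dualComponent_eq_bot hR]; infer_instance
    have : Subsingleton (Module.Dual ℂ (dualComponent R (k + 5))) :=
      ⟨fun f g => LinearMap.ext fun z => by rw [Subsingleton.elim z 0, map_zero, map_zero]⟩
    infer_instance
  exact h _ (five_le_koszulIdx n)

/-- Applying `d` contracts a form with a generator on the left. One contraction takes the form of
degree four to those of degree three, two take degree three to degree one with coefficients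
`ymCoeff`, and one takes degree one to degree zero. -/
theorem nonempty_koszulCoordinates [Nontrivial ι]
    (hR : R = Submodule.span ℂ (Set.range (ymTensor b))) : Nonempty (KoszulCoordinates b R) := by
  obtain ⟨g₀, g₁, g₃, g₄, h⟩ := exists_isDualForms hR
  obtain ⟨β₀, hβ₀⟩ := h.exists_basis_zero
  obtain ⟨β₁, hβ₁⟩ := h.exists_basis_one
  obtain ⟨β₃, hβ₃⟩ := h.exists_basis_three hR
  obtain ⟨β₄, hβ₄⟩ := h.exists_basis_four hR
  obtain ⟨e₀, he₀⟩ := exists_equiv_tensor_of_basis (A := HomogeneousAlgebra R) β₀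
  obtain ⟨e₁, he₁⟩ := exists_equiv_tensor_of_basis (A := HomogeneousAlgebra R) β₁
  obtain ⟨e₃, he₃⟩ := exists_equiv_tensor_of_basis (A := HomogeneousAlgebra R) β₃
  obtain ⟨e₄, he₄⟩ := exists_equiv_tensor_of_basis (A := HomogeneousAlgebra R) β₄
  simp only [hβ₀, Finset.univ_unique, Finset.sum_singleton] at he₀
  simp only [hβ₄, Finset.univ_unique, Finset.sum_singleton] at he₄
  simp only [hβ₁] at he₁
  simp only [hβ₃] at he₃
  let u := (LinearEquiv.funUnique Unit (HomogeneousAlgebra R) (HomogeneousAlgebra R)).symm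
  refine ⟨⟨u.trans e₀, e₁, e₃, u.trans e₄, fun a => ?_, fun a => ?_, fun a => ?_⟩⟩
  · have hd : ∀ i j, (g₁ i ∘ₗ LinearMap.mulLeft ℂ (dualGen b R j)).domRestrict (dualComponent R 0) =
        ((if j = i then (1 : ℂ) else 0) • g₀).domRestrict (dualComponent R 0) := fun i j =>
      domRestrict_eq (b := b) fun l hl => by
        obtain rfl := List.length_eq_zero_iff.1 hl
        have : g₁ i (dualGen b R j * dualWord b R []) = _ := h.one i j
        rw [LinearMap.comp_apply, LinearMap.mulLeft_apply, this]
        split_ifs <;> simp [h.zero]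
    change koszulD R 0 (e₁ a) = e₀ (u _)
    rw [he₁, he₀, map_sum]
    simp only [koszulD_tmul_domRestrict (b := b), hd]
    rw [show u (ymD1 (rightMul fun i => gen R (b i)) a) default =
      ∑ i, a i * gen R (b i) from ymD1_apply _ _, TensorProduct.sum_tmul]
    refine Finset.sum_congr rfl fun i _ => ?_
    rw [Finset.sum_eq_single i]
    · simp
    · intro j _ hj
      have : (0 : HomogeneousAlgebra (perp R) →ₗ[ℂ] ℂ).domRestrict (dualComponent R 0) = 0 := rfl
      simp [hj, this]
    · simp
  · have hd : ∀ n i j, ((g₃ n ∘ₗ LinearMap.mulLeft ℂ (dualGen b R i)) ∘ₗ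
        LinearMap.mulLeft ℂ (dualGen b R j)).domRestrict (dualComponent R 1) =
        ∑ k, ymCoeff n i j k • (g₁ k).domRestrict (dualComponent R 1) := fun n i j => by
      refine Eq.trans (domRestrict_eq (b := b) (g' := ∑ k, ymCoeff n i j k • g₁ k) fun l hl => ?_) ?_
      · obtain ⟨k, rfl⟩ := List.length_eq_one_iff.1 hl
        have : g₃ n (dualGen b R i * (dualGen b R j * dualWord b R [k])) = _ := h.three n i j k
        simp [this, h.one]
      · ext z; simp
    change koszulD R 1 (koszulD R 2 (e₃ a)) = e₁ _
    rw [he₃, he₁, map_sum, map_sum]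
    have hn : ∀ n, koszulD R 1 (koszulD R 2 (a n ⊗ₜ (g₃ n).domRestrict (dualComponent R 3))) =
        ∑ l, ((a n * gen R (b l) * gen R (b l)) ⊗ₜ[ℂ] (g₁ n).domRestrict (dualComponent R 1) -
          (2 : ℂ) • (a n * gen R (b l) * gen R (b n)) ⊗ₜ[ℂ] (g₁ l).domRestrict (dualComponent R 1) +
          (a n * gen R (b n) * gen R (b l)) ⊗ₜ[ℂ] (g₁ l).domRestrict (dualComponent R 1)) := by
      intro n
      rw [koszulD_tmul_domRestrict (b := b), map_sum, ← sum_ymCoeff n fun i j k =>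
        (a n * gen R (b i) * gen R (b j)) ⊗ₜ[ℂ] (g₁ k).domRestrict (dualComponent R 1)]
      refine Finset.sum_congr rfl fun i _ => ?_
      rw [koszulD_tmul_domRestrict (b := b)]
      refine Finset.sum_congr rfl fun j _ => ?_
      rw [hd, TensorProduct.tmul_sum]
      simp only [TensorProduct.tmul_smul]
    rw [Finset.sum_congr rfl fun n _ => hn n]
    simp only [ymD2_apply, rightMul_apply, TensorProduct.add_tmul, TensorProduct.sum_tmul,
      TensorProduct.sub_tmul, Finset.sum_add_distrib, Finset.sum_sub_distrib]
    rw [Finset.sum_comm (f := fun x y => (2 : ℂ) • (a x * gen R (b y) * gen R (b x)) ⊗ₜ[ℂ]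
        (g₁ y).domRestrict (dualComponent R 1)),
      Finset.sum_comm (f := fun x y => (a x * gen R (b x) * gen R (b y)) ⊗ₜ[ℂ]
        (g₁ y).domRestrict (dualComponent R 1))]
    simp only [two_smul, TensorProduct.add_tmul]
    abel
  · have hd : ∀ i, (g₄ ∘ₗ LinearMap.mulLeft ℂ (dualGen b R i)).domRestrict (dualComponent R 3) =
        (g₃ i).domRestrict (dualComponent R 3) := fun i =>
      domRestrict_eq (b := b) fun l hl => by
        obtain ⟨j, k, l, rfl⟩ := List.length_eq_three.1 hl
        have : g₄ (dualGen b R i * dualWord b R [j, k, l]) = _ := h.four i j k l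
        simp [this, h.three]
    change koszulD R 3 (e₄ (u a)) = e₃ _
    rw [he₃, he₄, koszulD_tmul_domRestrict (b := b)]
    simp only [hd]
    rfl

/-- The Koszul complex is exact in positive degrees. -/
theorem isKoszul [Nontrivial ι] (hR : R = Submodule.span ℂ (Set.range (ymTensor b))) :
    IsKoszul R := by
  obtain ⟨c⟩ := nonempty_koszulCoordinates hR
  have hx := isYangMills_gen hR
  obtain ⟨ε, hε⟩ := hx.exists_augmentation
  obtain ⟨h₃, h₃₂, h₂₁, -⟩ := hx.exact_augmentation hε
  have hd₀ : koszulDiff R 0 ∘ₗ c.e₁.toLinearMap = c.e₀.toLinearMap ∘ₗ ymD1 _ :=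
    LinearMap.ext c.diff₀
  have hd₁ : koszulDiff R 1 ∘ₗ c.e₂.toLinearMap = c.e₁.toLinearMap ∘ₗ ymD2 _ :=
    LinearMap.ext c.diff₁
  have hd₂ : koszulDiff R 2 ∘ₗ c.e₃.toLinearMap = c.e₂.toLinearMap ∘ₗ ymD3 _ :=
    LinearMap.ext c.diff₂
  rintro (_ | _ | _ | n)
  · exact Function.Exact.of_ladder_linearEquiv_of_exact hd₁ hd₀ h₂₁
  · exact Function.Exact.of_ladder_linearEquiv_of_exact hd₂ hd₁ h₃₂
  -- As `C_4 = 0`, exactness at `C_3` is injectivity of the last differential.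
  · have := subsingleton_koszulTerm hR 0
    intro z
    refine ⟨fun hz => ⟨0, ?_⟩, ?_⟩
    · obtain ⟨a, rfl⟩ := c.e₃.surjective z
      have : koszulDiff R 2 (c.e₃ a) = 0 := hz
      rw [c.diff₂, LinearEquiv.map_eq_zero_iff] at this
      rw [h₃ (this.trans (map_zero _).symm), map_zero, map_zero]
    · rintro ⟨y, rfl⟩
      rw [Subsingleton.elim y 0, map_zero, map_zero]
  · have := subsingleton_koszulTerm hR n
    intro z
    have hz : z = 0 := Subsingleton.elim (α := KoszulTerm R (n + 4)) z 0
    subst hz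
    simp only [map_zero, true_iff]
    exact ⟨0, map_zero _⟩

theorem nontrivial_of_gen (hR : R = Submodule.span ℂ (Set.range (ymTensor b))) :
    Nontrivial (HomogeneousAlgebra R) := by
  obtain ⟨ε, -⟩ := (isYangMills_gen hR).exists_augmentation
  exact ε.toRingHom.domain_nontrivial

theorem hasFiniteExtension [Nontrivial ι] (hR : R = Submodule.span ℂ (Set.range (ymTensor b))) :
    HasFiniteExtension R 3 := by
  obtain ⟨c⟩ := nonempty_koszulCoordinates hR
  have := nontrivial_of_gen hR
  refine ⟨fun n hn => ?_, c.e₃.symm.toEquiv.nontrivial⟩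
  obtain ⟨k, rfl⟩ := Nat.exists_eq_add_of_le' (Nat.succ_le_of_lt hn)
  exact subsingleton_koszulTerm hR k

end YangMills
end HomogeneousAlgebra

/-! ### Duality -/

namespace HomogeneousAlgebra

open IsYangMills MulOpposite

section Adjoint

variable {ι : Type} [Fintype ι] {A : Type} [Ring A] (x : ι → A)

theorem ymD1_mul (a : ι → A) (u : A) : ymD1 (rightMul x) a * u =
    ∑ i, a i * unop (ymD3 (rightMul fun i => op (x i)) (op u) i) := by
  rw [ymD1_apply, Finset.sum_mul]
  exact Finset.sum_congr rfl fun i _ => mul_assoc _ _ _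

theorem sum_ymD3_mul (a : A) (u : ι → A) : ∑ i, ymD3 (rightMul x) a i * u i =
    a * unop (ymD1 (rightMul fun i => op (x i)) fun i => op (u i)) := by
  rw [ymD1_apply, ← opAddEquiv_symm_apply, map_sum, Finset.mul_sum]
  exact Finset.sum_congr rfl fun i _ => mul_assoc _ _ _

/-- Passing to the opposite ring reverses the products `x_i x_j` and transposition exchanges `i` and
`j`; together they preserve the matrix of the quadratic map, which is therefore its own adjoint. -/
theorem sum_ymD2_mul (a u : ι → A) : ∑ i, ymD2 (rightMul x) a i * u i =
    ∑ i, a i * unop (ymD2 (rightMul fun i => op (x i)) (fun i => op (u i)) i) := by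
  simp only [ymD2_apply, rightMul_apply, ← opAddEquiv_symm_apply, map_add, map_sum, map_sub]
  simp only [opAddEquiv_symm_apply, unop_add, unop_mul, unop_op, add_mul, mul_add, Finset.sum_mul,
    Finset.mul_sum, sub_mul, mul_sub, Finset.sum_add_distrib, Finset.sum_sub_distrib, mul_assoc,
    two_smul]
  rw [Finset.sum_comm (f := fun i j => a j * (x j * (x i * u i))),
    Finset.sum_comm (f := fun i j => a j * (x i * (x j * u i)))]

end Adjoint

theorem augmentation_gen {K : Type u} [Field K] {E : Type v} [AddCommGroup E] [Module K E] {N : ℕ}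
    [NeZero N] (R : Submodule K (⨂[K]^N E)) (e : E) : augmentation R (gen R e) = 0 :=
  (RingQuot.liftAlgHom_mkAlgHom_apply K _ _ _).trans
    ((TensorAlgebra.lift_ι_apply (0 : E →ₗ[K] K) e))

section YangMills

variable {ι : Type} [Fintype ι] [DecidableEq ι] {b : Module.Basis ι ℂ (ι → ℂ)}
  {R : Submodule ℂ (⨂[ℂ]^3 (ι → ℂ))}

namespace KoszulCoordinates

theorem apply_eq_sum {M : Type*} [AddCommGroup M] [Module (HomogeneousAlgebra R) M]
    (e : (ι → HomogeneousAlgebra R) ≃ₗ[HomogeneousAlgebra R] M)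
    (φ : M →ₗ[HomogeneousAlgebra R] HomogeneousAlgebra R) (a : ι → HomogeneousAlgebra R) :
    φ (e a) = ∑ i, a i * φ (e (Pi.single i 1)) := by
  conv_lhs => rw [← Finset.univ_sum_single a]
  rw [map_sum, map_sum]
  refine Finset.sum_congr rfl fun i _ => ?_
  have : (Pi.single i (a i) : ι → HomogeneousAlgebra R) = a i • Pi.single i 1 := by
    rw [← Pi.single_smul, smul_eq_mul, mul_one]
  rw [this, map_smul, map_smul, smul_eq_mul]

theorem apply_eq_mul {M : Type*} [AddCommGroup M] [Module (HomogeneousAlgebra R) M]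
    (e : HomogeneousAlgebra R ≃ₗ[HomogeneousAlgebra R] M)
    (φ : M →ₗ[HomogeneousAlgebra R] HomogeneousAlgebra R) (a : HomogeneousAlgebra R) :
    φ (e a) = a * φ (e 1) := by
  rw [← smul_eq_mul, ← map_smul, ← map_smul, smul_eq_mul, mul_one]

/-- The linear form on a free module with given coordinates. -/
def linearForm {M : Type*} [AddCommGroup M] [Module (HomogeneousAlgebra R) M]
    (e : (ι → HomogeneousAlgebra R) ≃ₗ[HomogeneousAlgebra R] M) (u : ι → HomogeneousAlgebra R) :
    M →ₗ[HomogeneousAlgebra R] HomogeneousAlgebra R :=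
  (∑ i, (LinearMap.toSpanSingleton _ _ (u i)) ∘ₗ LinearMap.proj i) ∘ₗ e.symm.toLinearMap

theorem linearForm_apply {M : Type*} [AddCommGroup M] [Module (HomogeneousAlgebra R) M]
    (e : (ι → HomogeneousAlgebra R) ≃ₗ[HomogeneousAlgebra R] M) (u a : ι → HomogeneousAlgebra R) :
    linearForm e u (e a) = ∑ i, a i * u i := by
  simp [linearForm]

theorem ker_dualDiff_zero [Nontrivial ι] (c : KoszulCoordinates b R)
    (hR : R = Submodule.span ℂ (Set.range (ymTensor b))) :
    LinearMap.ker (dualDiff R 0) ≤ ⊥ := by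
  have hx := (isYangMills_gen hR).op
  obtain ⟨ε, hε⟩ := hx.exists_augmentation
  obtain ⟨h₃, -, -, -⟩ := hx.exact_augmentation hε
  intro φ hφ
  have hφ' : ∀ a, ymD1 (rightMul fun i => gen R (b i)) a * φ (c.e₀ 1) = 0 := fun a => by
    rw [← apply_eq_mul, ← c.diff₀]
    exact LinearMap.congr_fun hφ (c.e₁ a)
  have h0 : ymD3 (rightMul fun i => op (gen R (b i))) (op (φ (c.e₀ 1))) = 0 := by
    funext i
    have := hφ' (Pi.single i 1)
    rw [ymD1_mul, Finset.sum_eq_single i (by intro j _ hj; simp [hj]) (by simp)] at this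
    apply unop_injective
    simpa using this
  have h1 : φ (c.e₀ 1) = 0 := op_injective (h₃ (h0.trans (map_zero _).symm))
  rw [Submodule.mem_bot]
  refine LinearMap.ext fun z => ?_
  obtain ⟨a, rfl⟩ := c.e₀.surjective z
  rw [apply_eq_mul, h1, mul_zero, LinearMap.zero_apply]

theorem ker_dualDiff_one [Nontrivial ι] (c : KoszulCoordinates b R)
    (hR : R = Submodule.span ℂ (Set.range (ymTensor b))) :
    LinearMap.ker (dualDiff R 1) ≤ LinearMap.range (dualDiff R 0) := by
  have hx := (isYangMills_gen hR).op
  obtain ⟨ε, hε⟩ := hx.exists_augmentation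
  obtain ⟨-, h₃₂, -, -⟩ := hx.exact_augmentation hε
  intro φ hφ
  set u := fun i => φ (c.e₁ (Pi.single i 1))
  have hφ' : ∀ a, ∑ i, ymD2 (rightMul fun i => gen R (b i)) a i * u i = 0 := fun a => by
    rw [← apply_eq_sum, ← c.diff₁]
    exact LinearMap.congr_fun hφ (c.e₂ a)
  have h0 : ymD2 (rightMul fun i => op (gen R (b i))) (fun i => op (u i)) = 0 := by
    funext i
    have := hφ' (Pi.single i 1)
    rw [sum_ymD2_mul, Finset.sum_eq_single i (by intro j _ hj; simp [hj]) (by simp)] at this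
    apply unop_injective
    simpa using this
  obtain ⟨d, hd⟩ := (h₃₂ _).1 h0
  refine ⟨LinearMap.toSpanSingleton _ _ (unop d) ∘ₗ c.e₀.symm.toLinearMap, ?_⟩
  refine LinearMap.ext fun z => ?_
  obtain ⟨a, rfl⟩ := c.e₁.surjective z
  change LinearMap.toSpanSingleton _ _ (unop d) (c.e₀.symm (koszulDiff R 0 (c.e₁ a))) = _
  rw [c.diff₀, LinearEquiv.symm_apply_apply, LinearMap.toSpanSingleton_apply, smul_eq_mul, ymD1_mul,
    op_unop, hd, apply_eq_sum]
  rfl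

theorem ker_dualDiff_two [Nontrivial ι] (c : KoszulCoordinates b R)
    (hR : R = Submodule.span ℂ (Set.range (ymTensor b))) :
    LinearMap.ker (dualDiff R 2) ≤ LinearMap.range (dualDiff R 1) := by
  have hx := (isYangMills_gen hR).op
  obtain ⟨ε, hε⟩ := hx.exists_augmentation
  obtain ⟨-, -, h₂₁, -⟩ := hx.exact_augmentation hε
  intro φ hφ
  set u := fun i => φ (c.e₂ (Pi.single i 1))
  have hφ' : ∑ i, ymD3 (rightMul fun i => gen R (b i)) 1 i * u i = 0 := by
    rw [← apply_eq_sum, ← c.diff₂]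
    exact LinearMap.congr_fun hφ (c.e₃ 1)
  have h0 : ymD1 (rightMul fun i => op (gen R (b i))) (fun i => op (u i)) = 0 := by
    rw [sum_ymD3_mul, one_mul] at hφ'
    exact unop_injective hφ'
  obtain ⟨d, hd⟩ := (h₂₁ _).1 h0
  refine ⟨linearForm c.e₁ fun i => unop (d i), ?_⟩
  refine LinearMap.ext fun z => ?_
  obtain ⟨a, rfl⟩ := c.e₂.surjective z
  change linearForm c.e₁ _ (koszulDiff R 1 (c.e₂ a)) = _
  rw [c.diff₁, linearForm_apply, sum_ymD2_mul]
  simp only [op_unop]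
  rw [hd, apply_eq_sum]
  rfl

/-- A form on `C_3` is given by its value on the generator. It is a coboundary when this value lies
in the right ideal generated by the `x_i`, which is the augmentation ideal by exactness of the
resolution over `Aᵐᵒᵖ`. -/
theorem mem_range_dualDiff_two [Nontrivial ι] (c : KoszulCoordinates b R)
    (hR : R = Submodule.span ℂ (Set.range (ymTensor b)))
    (φ : DualTerm R 3) : φ ∈ LinearMap.range (dualDiff R 2) ↔ augmentation R (φ (c.e₃ 1)) = 0 := by
  have hx := (isYangMills_gen hR).op
  let ε : (HomogeneousAlgebra R)ᵐᵒᵖ →ₐ[ℂ] ℂ :=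
    (augmentation R).fromOpposite fun _ _ => Commute.all _ _
  have hε : ∀ i, ε (op (gen R (b i))) = 0 := fun i => augmentation_gen R (b i)
  obtain ⟨-, -, -, h⟩ := hx.exact_augmentation hε
  have hop := h (op (φ (c.e₃ 1)))
  refine Iff.trans ?_ hop.symm
  constructor
  · rintro ⟨ψ, rfl⟩
    refine ⟨fun i => op (ψ (c.e₂ (Pi.single i 1))), ?_⟩
    apply unop_injective
    change _ = ψ (koszulDiff R 2 (c.e₃ 1))
    rw [c.diff₂, apply_eq_sum, sum_ymD3_mul, one_mul]
  · rintro ⟨d, hd⟩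
    refine ⟨linearForm c.e₂ fun i => unop (d i), ?_⟩
    refine LinearMap.ext fun z => ?_
    obtain ⟨a, rfl⟩ := c.e₃.surjective z
    change linearForm c.e₂ _ (koszulDiff R 2 (c.e₃ a)) = _
    rw [c.diff₂, linearForm_apply, sum_ymD3_mul]
    simp only [op_unop]
    rw [hd, unop_op, ← apply_eq_mul]

end KoszulCoordinates

theorem isGorenstein [Nontrivial ι] (hR : R = Submodule.span ℂ (Set.range (ymTensor b))) :
    IsGorenstein R := by
  obtain ⟨c⟩ := nonempty_koszulCoordinates hR
  refine ⟨isKoszul hR, 3, hasFiniteExtension hR, fun k hk => ?_, ?_⟩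
  · apply subsingleton_subquotient
    interval_cases k
    · exact c.ker_dualDiff_zero hR
    · exact c.ker_dualDiff_one hR
    · exact c.ker_dualDiff_two hR
  · let ε : (HomogeneousAlgebra R)ᵐᵒᵖ →ₐ[ℂ] ℂ :=
      (augmentation R).fromOpposite fun _ _ => Commute.all _ _
    let : Module (HomogeneousAlgebra R)ᵐᵒᵖ ℂ := Module.compHom ℂ ε.toRingHom
    have hsmul : ∀ (a : HomogeneousAlgebra R) (z : ℂ), op a • z = augmentation R a * z :=
      fun _ _ => rfl
    let L : LinearMap.ker (dualDiff R 3) →ₗ[(HomogeneousAlgebra R)ᵐᵒᵖ] ℂ :=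
      { toFun := fun φ => augmentation R (φ.1 (c.e₃ 1))
        map_add' := fun φ ψ => map_add (augmentation R) _ _
        map_smul' := fun a φ => by
          have : (a • φ).1 (c.e₃ 1) = φ.1 (c.e₃ 1) * unop a := rfl
          rw [this, map_mul, mul_comm, RingHom.id_apply, ← op_unop a, hsmul, unop_op] }
    have hker : (coboundaries R 3).submoduleOf (LinearMap.ker (dualDiff R 3)) = LinearMap.ker L := by
      ext φ
      exact c.mem_range_dualDiff_two hR φ.1
    have hsurj : Function.Surjective L := by
      intro z
      -- Since `C_4 = 0`, every form on `C_3` is a cocycle.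
      have := subsingleton_koszulTerm hR 0
      refine ⟨⟨LinearMap.toSpanSingleton _ _ (algebraMap ℂ _ z) ∘ₗ c.e₃.symm.toLinearMap, ?_⟩, ?_⟩
      · refine LinearMap.ext fun y => ?_
        rw [Subsingleton.elim (α := KoszulTerm R 4) y 0, map_zero, map_zero]
      · change augmentation R (LinearMap.toSpanSingleton _ _ (algebraMap ℂ _ z)
          (c.e₃.symm (c.e₃ 1))) = z
        rw [LinearEquiv.symm_apply_apply, LinearMap.toSpanSingleton_apply, one_smul,
          AlgHom.commutes]
        rfl
    let e : DualCohomology R 3 ≃ₗ[(HomogeneousAlgebra R)ᵐᵒᵖ] ℂ :=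
      (Submodule.quotEquivOfEq _ _ hker).trans (L.quotKerEquivOfSurjective hsurj)
    exact ⟨e.toAddEquiv, fun a h => (e.map_smul (op a) h).trans (mul_comm _ _)⟩

end YangMills
end HomogeneousAlgebra

/-! ### The Yang–Mills relations in an orthonormal basis -/

section Diagonalization

variable {ι : Type} [Fintype ι] [DecidableEq ι]

open Matrix in
-- Take `P = U √D` from the spectral theorem; over `ℂ` negative eigenvalues have square roots too,
-- so the signature plays no role.
theorem exists_mul_transpose_eq_map_ofReal {h : Matrix ι ι ℝ} (hh : h.IsSymm) :
    ∃ P : Matrix ι ι ℂ, P * Pᵀ = h.map Complex.ofReal := by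
  have hA : h.IsHermitian := by rw [Matrix.IsHermitian, conjTranspose_eq_transpose_of_trivial, hh.eq]
  choose r hr using fun i => IsAlgClosed.exists_pow_nat_eq (hA.eigenvalues i : ℂ) two_pos
  refine ⟨(hA.eigenvectorUnitary : Matrix ι ι ℝ).map Complex.ofRealHom * diagonal r, ?_⟩
  have hd : diagonal r * diagonal r = (diagonal hA.eigenvalues).map Complex.ofRealHom := by
    rw [diagonal_mul_diagonal, diagonal_map (map_zero _)]
    exact congrArg diagonal (funext fun i => (pow_two (r i)).symm.trans (hr i))
  rw [transpose_mul, diagonal_transpose, Matrix.mul_assoc, ← Matrix.mul_assoc (diagonal r), hd,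
    ← transpose_map, ← Matrix.map_mul, ← Matrix.map_mul]
  conv_rhs => rw [hA.spectral_theorem, Unitary.conjStarAlgAut_apply, Matrix.mul_assoc]
  rfl

theorem exists_basis_sum_mul {h : Matrix ι ι ℝ} (hh : h.IsSymm) (hdet : IsUnit h.det) :
    ∃ b : Module.Basis ι ℂ (ι → ℂ), ∀ l m, ∑ i, b i l * b i m = (h l m : ℂ) := by
  obtain ⟨P, hP⟩ := exists_mul_transpose_eq_map_ofReal hh
  have hdetP : IsUnit P.det := by
    have := congrArg Matrix.det hP
    rw [Matrix.det_mul] at this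
    have h' := hdet.map Complex.ofRealHom
    rw [RingHom.map_det] at h'
    exact isUnit_of_mul_isUnit_left (this ▸ h' : IsUnit (P.det * P.transpose.det))
  -- The basis consists of the columns of `P`.
  refine ⟨(Pi.basisFun ℂ ι).map (Matrix.toLinearEquiv (Pi.basisFun ℂ ι) P hdetP), fun l m => ?_⟩
  have := congrFun (congrFun hP l) m
  rw [Matrix.mul_apply] at this
  simpa [Matrix.toLin_eq_toLin'] using this

theorem sum_bilin_basis {h : ι → ι → ℂ} {b : ι → ι → ℂ}
    (hb : ∀ l m, ∑ i, b i l * b i m = h l m) {X : Type*} [AddCommGroup X] [Module ℂ X]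
    (B : (ι → ℂ) →ₗ[ℂ] (ι → ℂ) →ₗ[ℂ] X) :
    ∑ i, B (b i) (b i) = ∑ l, ∑ m, h l m • B (Pi.single l 1) (Pi.single m 1) := by
  have hv : ∀ v : ι → ℂ, v = ∑ l, v l • (Pi.single l 1 : ι → ℂ) := fun v => by
    simpa using (pi_eq_sum_univ' v)
  calc ∑ i, B (b i) (b i)
      = ∑ i, ∑ l, ∑ m, (b i l * b i m) • B (Pi.single l 1) (Pi.single m 1) := by
        refine Finset.sum_congr rfl fun i _ => ?_
        conv_lhs => rw [hv (b i)]
        simp only [map_sum, map_smul, LinearMap.sum_apply, LinearMap.smul_apply, Finset.smul_sum,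
          smul_smul]
        rw [Finset.sum_comm]
        simp only [mul_comm]
    _ = _ := by
        simp only [← hb, Finset.sum_smul]
        rw [Finset.sum_comm]
        exact Finset.sum_congr rfl fun l _ => Finset.sum_comm

end Diagonalization

theorem exists_trilinear_tprod (E : Type*) [AddCommGroup E] [Module ℂ E] :
    ∃ T : E →ₗ[ℂ] E →ₗ[ℂ] E →ₗ[ℂ] ⨂[ℂ]^3 E,
      ∀ u v w, T u v w = PiTensorProduct.tprod ℂ ![u, v, w] := by
  let f := PiTensorProduct.tprod ℂ (s := fun _ : Fin 3 => E)
  have h0 : ∀ a b c d : E, Function.update ![a, b, c] 0 d = ![d, b, c] := fun a b c d => by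
    ext j; fin_cases j <;> rfl
  have h1 : ∀ a b c d : E, Function.update ![a, b, c] 1 d = ![a, d, c] := fun a b c d => by
    ext j; fin_cases j <;> rfl
  have h2 : ∀ a b c d : E, Function.update ![a, b, c] 2 d = ![a, b, d] := fun a b c d => by
    ext j; fin_cases j <;> rfl
  refine ⟨LinearMap.mk₂ ℂ (fun u v =>
    { toFun := fun w => f ![u, v, w]
      map_add' := fun x y => by simpa only [h2] using f.map_update_add ![u, v, 0] 2 x y
      map_smul' := fun r x => by simpa only [h2, RingHom.id_apply] using f.map_update_smul ![u, v, 0] 2 r x })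
    (fun x y v => ?_) (fun r x v => ?_) (fun u x y => ?_) (fun r u x => ?_), fun u v w => rfl⟩ <;>
  refine LinearMap.ext fun w => ?_
  · have := f.map_update_add ![0, v, w] 0 x y
    simp only [h0] at this
    exact this
  · have := f.map_update_smul ![0, v, w] 0 r x
    simp only [h0] at this
    exact this
  · have := f.map_update_add ![u, 0, w] 1 x y
    simp only [h1] at this
    exact this
  · have := f.map_update_smul ![u, 0, w] 1 r x
    simp only [h1] at this
    exact this

theorem span_range_map_basis {ι E X : Type*} [AddCommGroup E] [Module ℂ E] [AddCommGroup X]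
    [Module ℂ X] (b : Module.Basis ι ℂ E) (F : E →ₗ[ℂ] X) :
    Submodule.span ℂ (Set.range fun i => F (b i)) = LinearMap.range F := by
  rw [← Submodule.map_top, ← b.span_eq, Submodule.map_span, ← Set.range_comp]
  rfl

/-- The relation is a linear map `F` of its free slot, so its values on any basis span the range of
`F`. The two contracted slots may be computed with `g⁻¹` in the standard basis or as a sum of
squares in `b`. -/
theorem yangMillsRelations_eq {s : ℕ} {g : Matrix (Fin (s + 1)) (Fin (s + 1)) ℝ}
    {b : Module.Basis (Fin (s + 1)) ℂ (Fin (s + 1) → ℂ)}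
    (hb : ∀ l m, ∑ i, b i l * b i m = ((g⁻¹ l m : ℝ) : ℂ)) :
    yangMillsRelations g = Submodule.span ℂ (Set.range (HomogeneousAlgebra.ymTensor b)) := by
  obtain ⟨T, hT⟩ := exists_trilinear_tprod (Fin (s + 1) → ℂ)
  let F : (Fin (s + 1) → ℂ) →ₗ[ℂ] ⨂[ℂ]^3 (Fin (s + 1) → ℂ) :=
    ∑ l, (T (b l) (b l) - (2 : ℂ) • (T (b l)).flip (b l) + (T.flip (b l)).flip (b l))
  have hF : ∀ u, F u = ∑ l, T (b l) (b l) u - ∑ l, T (b l) u (b l) - ∑ l, T (b l) u (b l)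
      + ∑ l, T u (b l) (b l) := fun u => by
    simp only [F, LinearMap.sum_apply, LinearMap.add_apply, LinearMap.sub_apply,
      LinearMap.flip_apply, Finset.sum_add_distrib, Finset.sum_sub_distrib,
      two_smul, sub_sub]
  have h₁ : ∀ n, F (b n) = HomogeneousAlgebra.ymTensor b n := fun n => by
    simp only [F, LinearMap.sum_apply, LinearMap.add_apply, LinearMap.sub_apply,
      LinearMap.smul_apply, LinearMap.flip_apply, hT, HomogeneousAlgebra.ymTensor]
  have h₂ : ∀ u, F u = ∑ l, ∑ m, ((g⁻¹ l m : ℝ) : ℂ) •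
      (T (Pi.single l 1) (Pi.single m 1) u - T (Pi.single l 1) u (Pi.single m 1)
        - T (Pi.single m 1) u (Pi.single l 1) + T u (Pi.single m 1) (Pi.single l 1)) := fun u => by
    have e₁ := sum_bilin_basis hb (T.compr₂ (LinearMap.applyₗ u))
    have e₂ := sum_bilin_basis hb (T.flip u)
    have e₃ := sum_bilin_basis hb (T.flip u).flip
    have e₄ := sum_bilin_basis hb (T u).flip
    simp only [LinearMap.flip_apply, LinearMap.compr₂_apply, LinearMap.applyₗ_apply_apply]
      at e₁ e₂ e₃ e₄
    rw [hF]
    simp only [smul_add, smul_sub, Finset.sum_add_distrib, Finset.sum_sub_distrib, ← e₁, ← e₂, ← e₃,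
      ← e₄]
  have h₃ := span_range_map_basis b F
  rw [← span_range_map_basis (Pi.basisFun ℂ _) F] at h₃
  simp only [h₁, h₂, hT, Pi.basisFun_apply] at h₃
  exact h₃.symm
end

theorem theorem1 (s : ℕ) (hs : 1 ≤ s) (g : Matrix (Fin (s + 1)) (Fin (s + 1)) ℝ)
    (hsymm : g.IsSymm) (hinv : IsUnit g.det) :
    HomogeneousAlgebra.IsKoszul (yangMillsRelations g) ∧
    HomogeneousAlgebra.HasFiniteExtension (yangMillsRelations g) 3 ∧
    leftGlobalDimension (YangMillsAlgebra g) = 3 ∧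
    rightGlobalDimension (YangMillsAlgebra g) = 3 ∧
    HomogeneousAlgebra.IsGorenstein (yangMillsRelations g) := by
  have : Nontrivial (Fin (s + 1)) := Fin.nontrivial_iff_two_le.2 (Nat.succ_le_succ hs)
  have hsymm' : (g⁻¹).IsSymm := by rw [Matrix.IsSymm, Matrix.transpose_nonsing_inv, hsymm.eq]
  obtain ⟨b, hb⟩ := exists_basis_sum_mul hsymm' (Matrix.isUnit_nonsing_inv_det g hinv)
  have hR := yangMillsRelations_eq hb
  have hx := HomogeneousAlgebra.isYangMills_gen hR
  exact ⟨HomogeneousAlgebra.isKoszul hR, HomogeneousAlgebra.hasFiniteExtension hR,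
    hx.leftGlobalDimension_eq, hx.op.leftGlobalDimension_eq, HomogeneousAlgebra.isGorenstein hR⟩
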